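/- Let $\tau\in\mathbb C$ with $\operatorname{Im}\tau>0$, put $q=e^{2\pi i\tau}$, $(a;q)=\prod_{j\ge 0}(1-aq^j)$, and let $$\theta(x)=\theta(x,\tau)=\frac{\sin(\pi x)}{\pi}\,\frac{(q e^{2\pi i x};q)\,(q e^{-2\pi i x};q)}{(q;q)^{2}}$$ be the first Jacobi theta function normalized by $\theta'(0)=1$. A theta-polynomial of degree $m$ is an entire function $f$ such that, for some $A,B\in\mathbb C^\times$, $$f(x+1)=A(-1)^m f(x),\qquad f(x+\tau)=B(-1)^m e^{-\pi i m\tau-2\pi i m x}f(x).$$ Let $m\ge 1$, let $w\in\mathbb C$, let $\Lambda=\{w+a+b\tau : 0\le a<1,\ 0\le b<1\}$ and let $\Lambda'$ be the interior of $\Lambda$. Theorem. Let $z_1,\dots,z_{2m}\in\Lambda'$ be pairwise distinct. Then there exists $N>0$ such that for every $\mu\in\mathbb C$ with $|\mu|>N$ there are, up to multiplication by nonzero constants, exactly $\binom{2m}{m}$ meromorphic functions $F$ with the following property: there are pairwise distinct points $t_1,\dots,t_m\in\Lambda$ and a theta-polynomial $g$ of degree $m$ such that $$F(x)=\frac{g(x)}{\prod_{j=1}^m\theta(x-t_j)},$$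 $F$ has a simple pole at each $t_j$, and, for some constant $c\in\mathbb C^\times$ (which becomes $1$ after rescaling $F$), $$F'(x)=c\,e^{-2\pi i\mu x}\,\frac{\prod_{a=1}^{2m}\theta(x-z_a)}{\prod_{j=1}^m\theta(x-t_j)^2}.$$ -/

import Mathlib

namespace EllipticWronski

noncomputable section

/-- The infinite product `(a; q) = ∏_{j ≥ 0} (1 - a q^j)`, convergent for `‖q‖ < 1`. -/
def qProd (a q : ℂ) : ℂ := ∏' j : ℕ, (1 - a * q ^ j)

/-- The first Jacobi theta function normalized by `θ'(0, τ) = 1`: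
`θ(x, τ) = (sin (π x) / π) (q z; q) (q / z; q) (q; q)⁻²` with `z = e^{2π i x}`, `q = e^{2π i τ}`. -/
def theta (τ x : ℂ) : ℂ :=
  let q : ℂ := Complex.exp (2 * Real.pi * Complex.I * τ)
  let z : ℂ := Complex.exp (2 * Real.pi * Complex.I * x)
  Complex.sin (Real.pi * x) / Real.pi * qProd (q * z) q * qProd (q / z) q / qProd q q ^ 2

/-- A theta-polynomial of degree `m`: an entire function with
`f(x + 1) = A (-1)^m f(x)` and `f(x + τ) = B (-1)^m e^{-π i m τ - 2 π i m x} f(x)`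
for some multipliers `A, B ∈ ℂˣ`. -/
def IsThetaPolynomial (τ : ℂ) (m : ℕ) (f : ℂ → ℂ) : Prop :=
  Differentiable ℂ f ∧ ∃ A B : ℂ, A ≠ 0 ∧ B ≠ 0 ∧
    (∀ x, f (x + 1) = A * (-1) ^ m * f x) ∧
    (∀ x, f (x + τ) = B * (-1) ^ m *
      Complex.exp (-(Real.pi * Complex.I * m * τ) - 2 * Real.pi * Complex.I * m * x) * f x)

/-- The fundamental parallelogram of `ℤ + τ ℤ` with vertices `w, w + 1, w + τ, w + 1 + τ`,
with the sides `[w, w + 1)` and `[w, w + τ)` included and the two other sides excluded. -/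
def parallelogram (τ w : ℂ) : Set ℂ :=
  {x | ∃ a b : ℝ, 0 ≤ a ∧ a < 1 ∧ 0 ≤ b ∧ b < 1 ∧ x = w + a + b * τ}

/-- `F = g / f`, where `f = ∏ θ(x - t_j)` with distinct `t_1, …, t_m` in the parallelogram, `g` is
a theta-polynomial of degree `m`, and `F` has a simple pole at each of the `m` points `t_j`
(these are all the zeros of `f`, hence all the poles of `F`, in the parallelogram).
The meromorphic function `F` is represented by the function on `ℂ` with value `0` at the poles. -/
structure IsThetaRatio (τ w : ℂ) (m : ℕ) (t : Fin m → ℂ) (F : ℂ → ℂ) : Prop where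
  mem_parallelogram : ∀ j, t j ∈ parallelogram τ w
  injective : Function.Injective t
  eq_div : ∃ g : ℂ → ℂ, IsThetaPolynomial τ m g ∧ F = fun x => g x / ∏ j, theta τ (x - t j)
  simple_pole : ∀ j, meromorphicOrderAt F (t j) = -1

/-- Away from the lattice translates of the `t_j`, the derivative of `F` is, up to a nonzero constant
factor, `e^{-2 π i μ x} ∏ θ(x - z_a) / ∏ θ(x - t_j)^2`. -/
def HasThetaDerivative (τ : ℂ) (m : ℕ) (μ : ℂ) (z : Fin (2 * m) → ℂ) (t : Fin m → ℂ)
    (F : ℂ → ℂ) : Prop :=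
  ∃ c : ℂ, c ≠ 0 ∧ ∀ x : ℂ, (∀ j, theta τ (x - t j) ≠ 0) →
    HasDerivAt F (c * (Complex.exp (-(2 * Real.pi * Complex.I * μ * x)) *
      (∏ a, theta τ (x - z a)) / ∏ j, theta τ (x - t j) ^ 2)) x

/-- The functions `F = g / f` with derivative of the prescribed form. -/
def thetaRatios (τ w : ℂ) (m : ℕ) (μ : ℂ) (z : Fin (2 * m) → ℂ) : Set (ℂ → ℂ) :=
  {F | ∃ t : Fin m → ℂ, IsThetaRatio τ w m t F ∧ HasThetaDerivative τ m μ z t F}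

/-- Proportionality of functions: `F = c G` with `c` a nonzero constant. -/
def proportional : Setoid (ℂ → ℂ) := MulAction.orbitRel ℂˣ (ℂ → ℂ)

/-- The set of proportionality classes of the functions in `thetaRatios`. -/
def thetaRatioClasses (τ w : ℂ) (m : ℕ) (μ : ℂ) (z : Fin (2 * m) → ℂ) :
    Set (Quotient proportional) :=
  Quotient.mk proportional '' thetaRatios τ w m μ z

end

end EllipticWronski

/-! Write f = ∏ θ(x - t_j), W = e^{-2πiμx} ∏ θ(x - z_a) and ζ = θ'/θ. For F = g/f the condition on
F' reads g'f - gf' = cW.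

From functions to equations. If f has simple zeros, W/f² has an entire antiderivative up to poles
exactly when its residues vanish, that is, when W'f' = Wf'' at the zeros of f
(`exists_wronskian_eq`, `isBethe_of_isThetaRatio`). At the points t_j this is the Bethe system ∑_a
ζ(t_j - z_a) - 2 ∑_{k≠j} ζ(t_j - t_k) = 2πiμ (`isBethe_iff`), and quasi-periodicity carries it to
the other zeros. The solution g is unique up to adding multiples of f. Let α, β be the multipliers
that F must have under the translations by 1 and τ. If they are not both 1, exactly one choice of g
is a theta-polynomial (`exists_isThetaRatio`, `exists_eq_smul_of_isThetaRatio`), and |μ| > 2m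
excludes α = β = 1. So classes of F correspond to Bethe solutions up to permutation.

Counting as |μ| → ∞. Summing the equations over the t_j with a common limit modulo the lattice
cancels their interactions, so the sum can only diverge if that limit is some z_a
(`exists_sub_mem_lattice`). If k points t_j = z_a + s_j share the limit z_a, then to leading order
1/s_j - 2 ∑ 1/(s_j - s_l) = M with M = 2πiμ. With S = ∑ 1/s_j, summing gives S = kM, and summing
after multiplication by 1/s_j gives MS = S². Hence k(k-1)M² = 0 up to lower order, and k = 1
(`cluster_identity`, `limit_injective`). Near every m-tuple of distinct z_a a contraction argument
yields exactly one solution (`exists_unique_near`). Up to permutation the solutions are therefore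
indexed by the m-element subsets of the z_a. -/

namespace EllipticWronski

open Complex Filter Topology

/-! ### The infinite product (a; q). -/

section QProduct

variable {q : ℂ}

lemma summable_mul_pow (hq : ‖q‖ < 1) (a : ℂ) : Summable fun j : ℕ => ‖-(a * q ^ j)‖ := by
  simpa [norm_mul, norm_pow] using
    (summable_geometric_of_lt_one (norm_nonneg q) hq).mul_left ‖a‖

lemma multipliable_one_sub_mul_pow (hq : ‖q‖ < 1) (a : ℂ) :
    Multipliable fun j : ℕ => 1 - a * q ^ j := by
  simpa [sub_eq_add_neg] using multipliable_one_add_of_summable (summable_mul_pow hq a)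

lemma qProd_eq_mul (hq : ‖q‖ < 1) (a : ℂ) : qProd a q = (1 - a) * qProd (q * a) q := by
  have h := (multipliable_one_sub_mul_pow hq a)
  have h' := (multipliable_one_sub_mul_pow hq (q * a))
  unfold qProd
  rw [tprod_eq_zero_mul' (f := fun j : ℕ => 1 - a * q ^ j)]
  · simp only [pow_zero, mul_one]
    congr 1
    exact tprod_congr fun j => by ring
  · exact h'.congr fun j => by ring

lemma qProd_ne_zero (hq : ‖q‖ < 1) {a : ℂ} (ha : ∀ j : ℕ, a * q ^ j ≠ 1) : qProd a q ≠ 0 := by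
  have := tprod_one_add_ne_zero_of_summable (f := fun j : ℕ => -(a * q ^ j))
    (fun j => by
      rw [← sub_eq_add_neg, sub_ne_zero]
      exact (ha j).symm) (summable_mul_pow hq a)
  simpa [qProd, sub_eq_add_neg] using this

lemma differentiable_qProd (hq : ‖q‖ < 1) : Differentiable ℂ fun a => qProd a q := by
  intro a₀
  have hs : Summable fun j : ℕ => (‖a₀‖ + 1) * ‖q‖ ^ j :=
    (summable_geometric_of_lt_one (norm_nonneg q) hq).mul_left _
  have hp := hs.hasProdLocallyUniformlyOn_nat_one_add (f := fun j a => -(a * q ^ j))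
    (K := Metric.ball a₀ 1) Metric.isOpen_ball
    (.of_forall fun j a ha => by
      rw [norm_neg, norm_mul, norm_pow]
      have : ‖a‖ ≤ ‖a₀‖ + 1 := by
        have := norm_sub_norm_le a a₀
        rw [mem_ball_iff_norm] at ha
        linarith
      gcongr) (fun j => by fun_prop)
  have hd := hp.differentiableOn
    (.of_forall fun _ ↦ by simpa [Finset.prod_fn] using
      DifferentiableOn.finsetProd (fun _ _ ↦ by fun_prop)) Metric.isOpen_ball
  have := hd.differentiableAt (Metric.ball_mem_nhds a₀ one_pos)
  simpa [qProd, sub_eq_add_neg] using! this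

end QProduct

/-- The lattice `ℤ + τ ℤ`. -/
def lattice (τ : ℂ) : AddSubgroup ℂ where
  carrier := {x | ∃ a b : ℤ, x = a + b * τ}
  zero_mem' := ⟨0, 0, by simp⟩
  add_mem' := by
    rintro _ _ ⟨a, b, rfl⟩ ⟨c, d, rfl⟩
    exact ⟨a + c, b + d, by push_cast; ring⟩
  neg_mem' := by
    rintro _ ⟨a, b, rfl⟩
    exact ⟨-a, -b, by push_cast; ring⟩

/-! ### The theta function: quasi-periodicity, zeros, logarithmic derivative. -/

section Theta

variable {τ : ℂ}


lemma norm_nome_lt_one (hτ : 0 < τ.im) : ‖cexp (2 * Real.pi * I * τ)‖ < 1 := by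
  simpa using UpperHalfPlane.norm_exp_two_pi_I_lt_one ⟨τ, hτ⟩

/-- The sine supplies the factor 1 - z missing from (qz; q). In the form (z; q)(q/z; q) both the
shift by τ and the zeros can be read off from the products. -/
lemma theta_eq (hτ : 0 < τ.im) (x : ℂ) :
    theta τ x = -(2 * Real.pi * I)⁻¹ * cexp (-(Real.pi * I * x)) *
      qProd (cexp (2 * Real.pi * I * x)) (cexp (2 * Real.pi * I * τ)) *
      qProd (cexp (2 * Real.pi * I * τ) / cexp (2 * Real.pi * I * x))
        (cexp (2 * Real.pi * I * τ)) /
      qProd (cexp (2 * Real.pi * I * τ)) (cexp (2 * Real.pi * I * τ)) ^ 2 := by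
  have hs : Complex.sin (Real.pi * x) / Real.pi = -(2 * Real.pi * I)⁻¹ *
      cexp (-(Real.pi * I * x)) * (1 - cexp (2 * Real.pi * I * x)) := by
    have h1 : cexp (2 * Real.pi * I * x) = cexp (Real.pi * I * x) * cexp (Real.pi * I * x) := by
      rw [← Complex.exp_add]; ring_nf
    have h2 : cexp (-(Real.pi * I * x)) * cexp (Real.pi * I * x) = 1 := by
      rw [← Complex.exp_add]; simp
    have hpi : (Real.pi : ℂ) ≠ 0 := by exact_mod_cast Real.pi_ne_zero
    rw [Complex.sin, h1, show -(Real.pi * x) * I = -(Real.pi * I * x) by ring,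
      show Real.pi * x * I = Real.pi * I * x by ring]
    field_simp
    rw [I_sq]
    linear_combination (-cexp (Real.pi * I * x)) * h2
  rw [theta, hs, qProd_eq_mul (norm_nome_lt_one hτ) (cexp (2 * Real.pi * I * x))]
  ring

lemma theta_add_one (x : ℂ) : theta τ (x + 1) = -theta τ x := by
  have h1 : cexp (2 * Real.pi * I * (x + 1)) = cexp (2 * Real.pi * I * x) := by
    rw [mul_add, mul_one, Complex.exp_add, Complex.exp_two_pi_mul_I, mul_one]
  have h2 : Complex.sin (Real.pi * (x + 1)) = -Complex.sin (Real.pi * x) := by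
    rw [mul_add, mul_one, Complex.sin_add_pi]
  simp only [theta, h1, h2]
  ring

lemma theta_neg (x : ℂ) : theta τ (-x) = -theta τ x := by
  have h1 : cexp (2 * Real.pi * I * -x) = (cexp (2 * Real.pi * I * x))⁻¹ := by
    rw [← Complex.exp_neg]; ring_nf
  simp only [theta]
  rw [h1, div_inv_eq_mul, ← div_eq_mul_inv, mul_neg, Complex.sin_neg]
  ring

lemma theta_zero : theta τ 0 = 0 := by simp [theta]

/-- The shift replaces z by qz: the first product loses the factor 1 - z and the second gains 1 -
1/z. -/
lemma theta_add_tau (hτ : 0 < τ.im) (x : ℂ) :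
    theta τ (x + τ) =
      -(cexp (-(Real.pi * I * τ) - 2 * Real.pi * I * x) * theta τ x) := by
  have hq := norm_nome_lt_one hτ
  rw [theta_eq hτ, theta_eq hτ]
  set q := cexp (2 * Real.pi * I * τ) with hqd
  set z := cexp (2 * Real.pi * I * x) with hzd
  have hq0 : q ≠ 0 := Complex.exp_ne_zero _
  have hz0 : z ≠ 0 := Complex.exp_ne_zero _
  have h1 : cexp (2 * Real.pi * I * (x + τ)) = q * z := by
    rw [hqd, hzd, ← Complex.exp_add]; ring_nf
  have h2 : cexp (-(Real.pi * I * (x + τ))) =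
      cexp (-(Real.pi * I * x)) * cexp (-(Real.pi * I * τ)) := by
    rw [← Complex.exp_add]; ring_nf
  have h3 : cexp (-(Real.pi * I * τ) - 2 * Real.pi * I * x) = cexp (-(Real.pi * I * τ)) / z := by
    rw [hzd, Complex.exp_sub]
  have h4 : q / (q * z) = z⁻¹ := by field_simp
  rw [h1, h2, h3, h4, qProd_eq_mul hq z⁻¹, qProd_eq_mul hq z, ← div_eq_mul_inv q z]
  field_simp
  ring

lemma qProd_nome_ne_zero (hτ : 0 < τ.im) :
    qProd (cexp (2 * Real.pi * I * τ)) (cexp (2 * Real.pi * I * τ)) ≠ 0 := by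
  have hq := norm_nome_lt_one hτ
  refine qProd_ne_zero hq fun j h => ?_
  have h' := congrArg norm h
  rw [← pow_succ', norm_pow, norm_one] at h'
  exact (pow_lt_one₀ (norm_nonneg _) hq j.succ_ne_zero).ne h'

lemma differentiable_theta (hτ : 0 < τ.im) : Differentiable ℂ (theta τ) := by
  have hP := differentiable_qProd (norm_nome_lt_one hτ)
  have h : theta τ = fun x => Complex.sin (Real.pi * x) / Real.pi *
      qProd (cexp (2 * Real.pi * I * τ) * cexp (2 * Real.pi * I * x))
        (cexp (2 * Real.pi * I * τ)) *
      qProd (cexp (2 * Real.pi * I * τ) / cexp (2 * Real.pi * I * x))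
        (cexp (2 * Real.pi * I * τ)) /
      qProd (cexp (2 * Real.pi * I * τ)) (cexp (2 * Real.pi * I * τ)) ^ 2 := rfl
  rw [h]
  have h1 : Differentiable ℂ fun x : ℂ => qProd (cexp (2 * Real.pi * I * τ) *
      cexp (2 * Real.pi * I * x)) (cexp (2 * Real.pi * I * τ)) :=
    hP.comp (f := fun x : ℂ => cexp (2 * Real.pi * I * τ) * cexp (2 * Real.pi * I * x))
      (by fun_prop)
  have h2 : Differentiable ℂ fun x : ℂ => qProd (cexp (2 * Real.pi * I * τ) /
      cexp (2 * Real.pi * I * x)) (cexp (2 * Real.pi * I * τ)) :=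
    hP.comp (f := fun x : ℂ => cexp (2 * Real.pi * I * τ) / cexp (2 * Real.pi * I * x))
      (by fun_prop (disch := exact fun _ => Complex.exp_ne_zero _))
  fun_prop

lemma theta_ne_zero (hτ : 0 < τ.im) {x : ℂ} (hx : x ∉ lattice τ) : theta τ x ≠ 0 := by
  have hq := norm_nome_lt_one hτ
  have hI : (2 * Real.pi * I : ℂ) ≠ 0 := Complex.two_pi_I_ne_zero
  have key : ∀ n : ℤ, cexp (2 * Real.pi * I * x) ≠ cexp (2 * Real.pi * I * (n * τ)) := by
    intro n h
    obtain ⟨k, hk⟩ := Complex.exp_eq_exp_iff_exists_int.mp h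
    refine hx ⟨k, n, mul_left_cancel₀ hI ?_⟩
    rw [hk]; ring
  have hpow : ∀ j : ℕ, cexp (2 * Real.pi * I * τ) ^ j = cexp (2 * Real.pi * I * (j * τ)) := by
    intro j
    rw [← Complex.exp_nat_mul]; ring_nf
  rw [theta_eq hτ]
  refine div_ne_zero (mul_ne_zero (mul_ne_zero (mul_ne_zero (neg_ne_zero.mpr (inv_ne_zero hI))
    (Complex.exp_ne_zero _)) (qProd_ne_zero hq fun j hj => ?_)) (qProd_ne_zero hq fun j hj => ?_))
    (pow_ne_zero _ (qProd_nome_ne_zero hτ))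
  · apply key (-j)
    rw [hpow, ← Complex.exp_add] at hj
    have := eq_inv_of_mul_eq_one_left (a := cexp (2 * Real.pi * I * x))
      (b := cexp (2 * Real.pi * I * (j * τ))) (by rw [← Complex.exp_add]; exact hj)
    rw [this, ← Complex.exp_neg]
    push_cast; ring_nf
  · apply key (j + 1)
    rw [div_mul_eq_mul_div, ← pow_succ', div_eq_one_iff_eq (Complex.exp_ne_zero _), hpow] at hj
    rw [← hj]
    push_cast; ring_nf

/-- Invariance under the two generators suffices. It serves both for the zeros of θ and for the
residue conditions at the zeros of a theta product. -/
lemma iff_add_of_mem_lattice {p : ℂ → Prop} (h1 : ∀ x, p (x + 1) ↔ p x)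
    (h2 : ∀ x, p (x + τ) ↔ p x) {ω : ℂ} (hω : ω ∈ lattice τ) (x : ℂ) : p (x + ω) ↔ p x := by
  obtain ⟨a, b, rfl⟩ := hω
  have hb : ∀ x, p (x + b * τ) ↔ p x := by
    intro x
    induction b using Int.induction_on with
    | zero => simp
    | succ n ih =>
      refine Iff.trans ?_ ih
      convert h2 _ using 2
      push_cast; ring
    | pred n ih =>
      refine Iff.trans ?_ ih
      convert (h2 _).symm using 2
      push_cast; ring
  have ha : ∀ x, p (x + a) ↔ p x := by
    intro x
    induction a using Int.induction_on with
    | zero => simp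
    | succ n ih =>
      refine Iff.trans ?_ ih
      convert h1 _ using 2
      push_cast; ring
    | pred n ih =>
      refine Iff.trans ?_ ih
      convert (h1 _).symm using 2
      push_cast; ring
  rw [← add_assoc, hb, ha]

lemma theta_eq_zero_of_mem (hτ : 0 < τ.im) {x : ℂ} (hx : x ∈ lattice τ) : theta τ x = 0 := by
  have := (iff_add_of_mem_lattice (p := fun y => theta τ y = 0)
    (fun y => by simp [theta_add_one]) (fun y => by simp [theta_add_tau hτ]) hx 0).mpr theta_zero
  simpa using this

lemma theta_eq_zero_iff (hτ : 0 < τ.im) {x : ℂ} : theta τ x = 0 ↔ x ∈ lattice τ :=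
  ⟨fun h => by_contra fun hx => theta_ne_zero hτ hx h, theta_eq_zero_of_mem hτ⟩

lemma hasDerivAt_theta_zero (hτ : 0 < τ.im) : HasDerivAt (theta τ) 1 0 := by
  have hP := differentiable_qProd (norm_nome_lt_one hτ)
  set q := cexp (2 * Real.pi * I * τ) with hqd
  have hpi : (Real.pi : ℂ) ≠ 0 := by exact_mod_cast Real.pi_ne_zero
  have h1 : Differentiable ℂ fun x : ℂ => qProd (q * cexp (2 * Real.pi * I * x)) q :=
    hP.comp (f := fun x : ℂ => q * cexp (2 * Real.pi * I * x)) (by fun_prop)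
  have h2 : Differentiable ℂ fun x : ℂ => qProd (q / cexp (2 * Real.pi * I * x)) q :=
    hP.comp (f := fun x : ℂ => q / cexp (2 * Real.pi * I * x))
      (by fun_prop (disch := exact fun _ => Complex.exp_ne_zero _))
  have hs : HasDerivAt (fun x : ℂ => Complex.sin (Real.pi * x) / Real.pi) 1 0 := by
    have := ((Complex.hasDerivAt_sin (Real.pi * 0)).comp (0 : ℂ)
      ((hasDerivAt_id (0 : ℂ)).const_mul (Real.pi : ℂ))).div_const (Real.pi : ℂ)
    simpa [Function.comp_def, hpi] using this
  have h : HasDerivAt (theta τ) _ 0 :=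
    ((hs.mul (h1 0).hasDerivAt).mul (h2 0).hasDerivAt).div_const (qProd q q ^ 2)
  convert h using 1
  have := qProd_nome_ne_zero hτ
  rw [← hqd] at this
  simp [field, this, pow_two]

/-- The entire function `θ(x) / x`. -/
noncomputable def thetaQuot (τ : ℂ) : ℂ → ℂ := dslope (theta τ) 0

lemma differentiable_thetaQuot (hτ : 0 < τ.im) : Differentiable ℂ (thetaQuot τ) := by
  rw [← differentiableOn_univ]
  exact (Complex.differentiableOn_dslope Filter.univ_mem).mpr
    (differentiable_theta hτ).differentiableOn

lemma thetaQuot_zero (hτ : 0 < τ.im) : thetaQuot τ 0 = 1 := by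
  rw [thetaQuot, dslope_same, (hasDerivAt_theta_zero hτ).deriv]

lemma mul_thetaQuot (x : ℂ) : x * thetaQuot τ x = theta τ x := by
  have := sub_smul_dslope (theta τ) 0 x
  simpa [theta_zero, thetaQuot] using this

lemma thetaQuot_neg (x : ℂ) : thetaQuot τ (-x) = thetaQuot τ x := by
  rcases eq_or_ne x 0 with rfl | hx
  · simp
  · have h := mul_thetaQuot (τ := τ) (-x)
    rw [theta_neg, ← mul_thetaQuot x] at h
    exact mul_left_cancel₀ (neg_ne_zero.mpr hx) (by rw [h]; ring)

lemma deriv_neg_of_even {f : ℂ → ℂ} (hf : ∀ x, f (-x) = f x) (x : ℂ) :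
    deriv f (-x) = -deriv f x := by
  have h : (fun y => f (-y)) = f := funext hf
  have := deriv_comp_neg f x
  rw [h] at this
  rw [this, neg_neg]

lemma deriv_neg_of_odd {f : ℂ → ℂ} (hf : ∀ x, f (-x) = -f x) (x : ℂ) :
    deriv f (-x) = deriv f x := by
  have h : (fun y => f (-y)) = -f := funext hf
  have := deriv_comp_neg f x
  rw [h, deriv.neg] at this
  simpa using this.symm

/-- The logarithmic derivative of the theta function. -/
noncomputable def zetaFun (τ : ℂ) : ℂ → ℂ := logDeriv (theta τ)

/-- The regular part at `0` of the logarithmic derivative of the theta function. -/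
noncomputable def zetaReg (τ : ℂ) : ℂ → ℂ := logDeriv (thetaQuot τ)

lemma zetaFun_neg (x : ℂ) : zetaFun τ (-x) = -zetaFun τ x := by
  rw [zetaFun, logDeriv_apply, logDeriv_apply, deriv_neg_of_odd theta_neg, theta_neg, div_neg]

lemma zetaReg_neg (x : ℂ) : zetaReg τ (-x) = -zetaReg τ x := by
  rw [zetaReg, logDeriv_apply, logDeriv_apply, deriv_neg_of_even thetaQuot_neg, thetaQuot_neg,
    neg_div]

lemma zetaReg_zero : zetaReg τ 0 = 0 := by
  have := zetaReg_neg (τ := τ) 0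
  rw [neg_zero] at this
  exact self_eq_neg.mp this

lemma thetaQuot_ne_zero {x : ℂ} (hx : theta τ x ≠ 0) : thetaQuot τ x ≠ 0 := by
  intro h
  rw [← mul_thetaQuot, h, mul_zero] at hx
  exact hx rfl

/-- Isolates the pole at 0; the remainder is odd and analytic there, which is all that the
asymptotic analysis uses. -/
lemma zetaFun_eq (hτ : 0 < τ.im) {x : ℂ} (hx : theta τ x ≠ 0) :
    zetaFun τ x = 1 / x + zetaReg τ x := by
  have hx0 : x ≠ 0 := by rintro rfl; exact hx theta_zero
  have h : theta τ = fun x => x * thetaQuot τ x := funext fun x => (mul_thetaQuot x).symm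
  rw [zetaFun, h, logDeriv_mul x hx0 (thetaQuot_ne_zero hx) differentiableAt_fun_id
    (differentiable_thetaQuot hτ x)]
  simp [zetaReg, logDeriv_apply]

lemma analyticAt_zetaFun (hτ : 0 < τ.im) {x : ℂ} (hx : theta τ x ≠ 0) :
    AnalyticAt ℂ (zetaFun τ) x :=
  ((differentiable_theta hτ).analyticAt x).deriv.div ((differentiable_theta hτ).analyticAt x) hx

lemma analyticAt_zetaReg (hτ : 0 < τ.im) {x : ℂ} (hx : thetaQuot τ x ≠ 0) :
    AnalyticAt ℂ (zetaReg τ) x :=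
  ((differentiable_thetaQuot hτ).analyticAt x).deriv.div
    ((differentiable_thetaQuot hτ).analyticAt x) hx

lemma _root_.AnalyticAt.exists_lipschitz_ball {f : ℂ → ℂ} {p : ℂ} (hf : AnalyticAt ℂ f p) :
    ∃ r > 0, ∃ K : ℝ, ∀ x ∈ Metric.ball p r, ∀ y ∈ Metric.ball p r,
      ‖f x - f y‖ ≤ K * ‖x - y‖ := by
  obtain ⟨K, t, ht, hK⟩ := (hf.contDiffAt (n := 1)).exists_lipschitzOnWith
  obtain ⟨r, hr, hrt⟩ := Metric.mem_nhds_iff.mp ht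
  exact ⟨r, hr, K, fun x hx y hy => hK.norm_sub_le (hrt hx) (hrt hy)⟩

end Theta

/-! ### Solving g'f - gf' = W in holomorphic functions. -/

/-- Two holomorphic functions whose Wronskian vanishes on a connected open set are proportional. -/
lemma eq_smul_of_wronskian_eq_zero {U : Set ℂ} (hU : IsOpen U) (hUc : IsPreconnected U)
    {f d : ℂ → ℂ} (hf : DifferentiableOn ℂ f U) (hd : DifferentiableOn ℂ d U) {x₀ : ℂ}
    (hx₀ : x₀ ∈ U) (hfx : f x₀ ≠ 0) (h : ∀ x ∈ U, deriv d x * f x = d x * deriv f x) :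
    ∀ x ∈ U, d x = d x₀ / f x₀ * f x := by
  have hev : ∀ᶠ x in 𝓝 x₀, x ∈ U ∧ f x ≠ 0 :=
    (show ∀ᶠ x in 𝓝 x₀, x ∈ U from hU.mem_nhds hx₀).and
      ((hf.continuousOn.continuousAt (hU.mem_nhds hx₀)).eventually_ne hfx)
  obtain ⟨r, hr, hball⟩ := Metric.eventually_nhds_iff_ball.mp hev
  have hconst : ∀ x ∈ Metric.ball x₀ r, d x / f x = d x₀ / f x₀ := by
    intro x hx
    refine Metric.isOpen_ball.is_const_of_deriv_eq_zero (convex_ball x₀ r).isPreconnected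
      (f := fun x => d x / f x) (fun y hy => ?_) (fun y hy => ?_) hx (Metric.mem_ball_self hr)
    · obtain ⟨hyU, hfy⟩ := hball y hy
      exact ((hd.differentiableAt (hU.mem_nhds hyU)).fun_div
        (hf.differentiableAt (hU.mem_nhds hyU)) hfy).differentiableWithinAt
    · obtain ⟨hyU, hfy⟩ := hball y hy
      have := deriv_fun_div (hd.differentiableAt (hU.mem_nhds hyU))
        (hf.differentiableAt (hU.mem_nhds hyU)) hfy
      rw [this, h y hyU]
      simp
  have hd' : DifferentiableOn ℂ (fun x => d x₀ / f x₀ * f x) U := hf.const_mul _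
  refine (hd.analyticOnNhd hU).eqOn_of_preconnected_of_eventuallyEq (hd'.analyticOnNhd hU) hUc
    hx₀ ?_
  filter_upwards [Metric.ball_mem_nhds x₀ hr] with x hx
  rw [← hconst x hx, div_mul_cancel₀ _ (hball x hx).2]

/-- An analytic function vanishing to second order at a simple zero of `f` is divisible by `f ^ 2`
near this point. -/
lemma exists_eq_sq_mul {f V : ℂ → ℂ} {s : ℂ} (hf : AnalyticAt ℂ f s) (hV : AnalyticAt ℂ V s)
    (h : f s = 0 → deriv f s ≠ 0 ∧ V s = 0 ∧ deriv V s = 0) :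
    ∃ k : ℂ → ℂ, AnalyticAt ℂ k s ∧ ∀ᶠ x in 𝓝 s, V x = f x ^ 2 * k x := by
  by_cases hfs : f s = 0
  · obtain ⟨h1, h2, h3⟩ := h hfs
    have hds : ∀ {g : ℂ → ℂ}, AnalyticAt ℂ g s → AnalyticAt ℂ (dslope g s) s := by
      rintro g ⟨p, hp⟩
      exact ⟨_, hp.has_fpower_series_dslope_fslope⟩
    have hf1 := hds hf
    have hV1 := hds hV
    have hV2 := hds hV1
    have hne : dslope f s s ≠ 0 := by rwa [dslope_same]
    refine ⟨fun x => dslope (dslope V s) s x / dslope f s x ^ 2, hV2.div (hf1.pow 2)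
      (pow_ne_zero _ hne), ?_⟩
    filter_upwards [hf1.continuousAt.eventually_ne hne] with x hx
    have e1 := sub_smul_dslope f s x
    have e2 := sub_smul_dslope V s x
    have e3 := sub_smul_dslope (dslope V s) s x
    rw [dslope_same, h3] at e3
    simp only [smul_eq_mul, hfs, h2, sub_zero] at e1 e2 e3
    rw [← e1, ← e2, ← e3]
    field_simp
  · refine ⟨fun x => V x / f x ^ 2, hV.div (hf.pow 2) (pow_ne_zero _ hfs), ?_⟩
    filter_upwards [hf.continuousAt.eventually_ne hfs] with x hx
    field_simp

lemma exists_differentiableOn_eq_sq_mul {U : Set ℂ} (hU : IsOpen U) {f V : ℂ → ℂ}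
    (hf : DifferentiableOn ℂ f U) (hV : DifferentiableOn ℂ V U)
    (h : ∀ x ∈ U, f x = 0 → deriv f x ≠ 0 ∧ V x = 0 ∧ deriv V x = 0) :
    ∃ k : ℂ → ℂ, DifferentiableOn ℂ k U ∧ ∀ x ∈ U, V x = f x ^ 2 * k x := by
  have hfa := hf.analyticOnNhd hU
  have hVa := hV.analyticOnNhd hU
  have hloc : ∀ x : ℂ, ∃ k : ℂ → ℂ, x ∈ U →
      AnalyticAt ℂ k x ∧ ∀ᶠ y in 𝓝 x, V y = f y ^ 2 * k y := by
    intro x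
    by_cases hx : x ∈ U
    · obtain ⟨k, hk⟩ := exists_eq_sq_mul (hfa x hx) (hVa x hx) (h x hx)
      exact ⟨k, fun _ => hk⟩
    · exact ⟨0, fun h => absurd h hx⟩
  choose k hk using hloc
  -- The local quotients are glued along the diagonal: the zeros of f are isolated, so near x the
  -- equation V = f²k determines the quotient away from x, and at x itself the value is that of `k
  -- x`.
  refine ⟨fun x => k x x, fun x hx => ?_, fun x hx => (hk x hx).2.self_of_nhds⟩
  have hne : ∀ᶠ y in 𝓝[≠] x, f y ≠ 0 := by
    by_cases hfx : f x = 0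
    · have hd := (hfa x hx).differentiableAt.hasDerivAt
      have := hd.eventually_ne (h x hx hfx).1 (c := 0)
      simpa using this
    · exact ((hfa x hx).continuousAt.eventually_ne hfx).filter_mono nhdsWithin_le_nhds
  have heq : (fun y => k y y) =ᶠ[𝓝 x] k x := by
    rw [eventually_nhdsWithin_iff] at hne
    filter_upwards [hne, hU.mem_nhds hx, (hk x hx).2] with y h1 h2 h3
    by_cases hyx : y = x
    · rw [hyx]
    · have h4 := (hk y h2).2.self_of_nhds
      rw [h3] at h4
      exact (mul_left_cancel₀ (pow_ne_zero 2 (h1 hyx)) h4).symm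
  exact ((hk x hx).1.congr heq.symm).differentiableAt.differentiableWithinAt

/-- On a disk, the equation `g' f - g f' = W` is solvable when its local obstructions at the
(simple) zeros of `f` vanish. -/
lemma exists_wronskian_eq_on_ball {f W : ℂ → ℂ} (hf : Differentiable ℂ f) (hW : Differentiable ℂ W)
    (h : ∀ x, f x = 0 → deriv f x ≠ 0 ∧
      deriv W x * deriv f x = W x * deriv (deriv f) x) (R : ℝ) :
    ∃ g : ℂ → ℂ, DifferentiableOn ℂ g (Metric.ball 0 R) ∧
      ∀ x ∈ Metric.ball 0 R, deriv g x * f x - g x * deriv f x = W x := by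
  have hfin : (Metric.closedBall (0 : ℂ) R ∩ {x | f x = 0}).Finite := by
    by_contra hinf
    obtain ⟨x, hx, hacc⟩ := Set.Infinite.exists_accPt_of_subset_isCompact hinf
      ((isCompact_closedBall 0 R).inter_right (isClosed_eq hf.continuous continuous_const))
      Set.Subset.rfl
    have hne := (hf x).hasDerivAt.eventually_ne (h x hx.2).1 (c := 0)
    obtain ⟨y, hy1, hy2⟩ := ((accPt_iff_frequently_nhdsNE.mp hacc).and_eventually hne).exists
    exact hy2 hy1.2
  set S := hfin.toFinset with hS
  -- At a zero s of f the equation forces g(s) = -W(s)/f'(s). With p interpolating these values, the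
  -- error V = W - (p'f - pf') vanishes at s, and the obstruction condition makes V' vanish too.
  set p := Lagrange.interpolate S id (fun s => -W s / deriv f s) with hp
  have hps : ∀ s ∈ S, p.eval s = -W s / deriv f s := fun s hs =>
    Lagrange.eval_interpolate_at_node (v := id) _ (Function.injective_id.injOn) hs
  have hdf : Differentiable ℂ (deriv f) := hf.deriv
  set V : ℂ → ℂ := fun x => W x - (p.derivative.eval x * f x - p.eval x * deriv f x) with hVdef
  have hV : Differentiable ℂ V := by
    have h1 := p.differentiable
    have h2 := p.derivative.differentiable
    exact hW.sub ((h2.mul hf).sub (h1.mul hdf))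
  have hdV : ∀ x, deriv V x = deriv W x -
      (p.derivative.derivative.eval x * f x - p.eval x * deriv (deriv f) x) := by
    intro x
    have := (hW x).hasDerivAt.fun_sub (((p.derivative.hasDerivAt x).fun_mul
      (hf x).hasDerivAt).fun_sub ((p.hasDerivAt x).fun_mul (hdf x).hasDerivAt))
    rw [hVdef, this.deriv]
    ring
  obtain ⟨k, hk, hVk⟩ := exists_differentiableOn_eq_sq_mul (U := Metric.ball 0 R)
    Metric.isOpen_ball hf.differentiableOn hV.differentiableOn (fun x hx hfx => by
      obtain ⟨h1, h2⟩ := h x hfx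
      have hxS : x ∈ S := by
        rw [hS, Set.Finite.mem_toFinset]
        exact ⟨Metric.ball_subset_closedBall hx, hfx⟩
      refine ⟨h1, ?_, ?_⟩
      · simp only [hVdef, hfx, hps x hxS]
        field_simp
        ring
      · rw [hdV, hfx, hps x hxS]
        field_simp
        linear_combination h2)
  -- With V = f²k and K' = k, adding Kf to p adds K'f² = V to p'f - pf', which corrects it to W.
  obtain ⟨K, hK⟩ := hk.isExactOn_ball
  refine ⟨fun x => p.eval x + K x * f x, fun x hx => ?_, fun x hx => ?_⟩
  · exact ((p.hasDerivAt x).fun_add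
      ((hK x hx).fun_mul (hf x).hasDerivAt)).differentiableAt.differentiableWithinAt
  · rw [((p.hasDerivAt x).fun_add ((hK x hx).fun_mul (hf x).hasDerivAt)).deriv]
    have := hVk x hx
    simp only [hVdef] at this
    linear_combination -this

/-- Over the whole plane, the equation `g' f - g f' = W` is solvable when its local obstructions at
the (simple) zeros of `f` vanish. -/
lemma exists_wronskian_eq {f W : ℂ → ℂ} (hf : Differentiable ℂ f) (hW : Differentiable ℂ W)
    (h : ∀ x, f x = 0 → deriv f x ≠ 0 ∧
      deriv W x * deriv f x = W x * deriv (deriv f) x) :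
    ∃ g : ℂ → ℂ, Differentiable ℂ g ∧ ∀ x, deriv g x * f x - g x * deriv f x = W x := by
  obtain ⟨x₀, hx₀⟩ : ∃ x₀, f x₀ ≠ 0 := by
    by_contra! hall
    have : f = fun _ => 0 := funext hall
    exact (h 0 (hall 0)).1 (by rw [this]; simp)
  have hball : ∀ n : ℕ, ∃ g : ℂ → ℂ, DifferentiableOn ℂ g (Metric.ball 0 (‖x₀‖ + 1 + n)) ∧
      (∀ x ∈ Metric.ball 0 (‖x₀‖ + 1 + n), deriv g x * f x - g x * deriv f x = W x) ∧
      g x₀ = 0 := by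
    intro n
    obtain ⟨g, hg, hgW⟩ := exists_wronskian_eq_on_ball hf hW h (‖x₀‖ + 1 + n)
    -- Solutions differ by multiples of f, so the normalization g(x₀) = 0 makes them unique and lets
    -- them be glued over the balls.
    refine ⟨fun x => g x - g x₀ / f x₀ * f x, hg.sub (hf.differentiableOn.const_mul _),
      fun x hx => ?_, by field_simp; ring⟩
    have hgx := hg.differentiableAt (Metric.isOpen_ball.mem_nhds hx)
    rw [(hgx.hasDerivAt.fun_sub ((hf x).hasDerivAt.const_mul (g x₀ / f x₀))).deriv, ← hgW x hx]
    ring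
  choose g hg hgW hg0 using hball
  have hx₀mem : ∀ n : ℕ, x₀ ∈ Metric.ball (0 : ℂ) (‖x₀‖ + 1 + n) := by
    intro n
    rw [mem_ball_zero_iff]
    have : (0 : ℝ) ≤ n := n.cast_nonneg
    linarith
  have hagree : ∀ n k : ℕ, n ≤ k → ∀ x ∈ Metric.ball (0 : ℂ) (‖x₀‖ + 1 + n), g k x = g n x := by
    intro n k hnk x hx
    have hsub : Metric.ball (0 : ℂ) (‖x₀‖ + 1 + n) ⊆ Metric.ball 0 (‖x₀‖ + 1 + k) :=
      Metric.ball_subset_ball (by gcongr)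
    have := eq_smul_of_wronskian_eq_zero Metric.isOpen_ball (convex_ball _ _).isPreconnected
      hf.differentiableOn (((hg k).mono hsub).sub (hg n)) (hx₀mem n) hx₀ (fun y hy => by
        have h1 := (hg n).differentiableAt (Metric.isOpen_ball.mem_nhds hy)
        have h2 := (hg k).differentiableAt (Metric.isOpen_ball.mem_nhds (hsub hy))
        rw [(h2.hasDerivAt.sub h1.hasDerivAt).deriv]
        simp only [Pi.sub_apply]
        linear_combination hgW k y (hsub hy) - hgW n y hy) x hx
    simp only [Pi.sub_apply, hg0, sub_self, zero_div, zero_mul] at this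
    exact sub_eq_zero.mp this
  have hmem : ∀ x : ℂ, ∃ n : ℕ, x ∈ Metric.ball (0 : ℂ) (‖x₀‖ + 1 + n) := by
    intro x
    obtain ⟨n, hn⟩ := exists_nat_gt ‖x‖
    refine ⟨n, ?_⟩
    rw [mem_ball_zero_iff]
    have := norm_nonneg x₀
    linarith
  choose N hN using hmem
  have heq : ∀ (n : ℕ) (x : ℂ), x ∈ Metric.ball (0 : ℂ) (‖x₀‖ + 1 + n) → g (N x) x = g n x := by
    intro n x hx
    rcases le_total n (N x) with hle | hle
    · exact hagree _ _ hle x hx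
    · exact (hagree _ _ hle x (hN x)).symm
  have hev : ∀ x, (fun y => g (N y) y) =ᶠ[𝓝 x] g (N x) := fun x => by
    filter_upwards [Metric.isOpen_ball.mem_nhds (hN x)] with y hy using heq _ _ hy
  refine ⟨fun x => g (N x) x, fun x => ?_, fun x => ?_⟩
  · exact (((hg (N x)).differentiableAt (Metric.isOpen_ball.mem_nhds (hN x)))).congr_of_eventuallyEq
      (hev x)
  · rw [(hev x).deriv_eq]
    exact hgW _ x (hN x)

/-! ### Theta products, their multipliers and the Bethe equations. -/

section Products

variable {τ : ℂ} {n m : ℕ}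

/-- The product `∏ θ(x - t_j)`. -/
noncomputable def thetaProd (τ : ℂ) (t : Fin n → ℂ) (x : ℂ) : ℂ := ∏ j, theta τ (x - t j)

/-- The function `e^{-2 π i μ x} ∏ θ(x - z_a)`. -/
noncomputable def twistedProd (τ μ : ℂ) (z : Fin n → ℂ) (x : ℂ) : ℂ :=
  cexp (-(2 * Real.pi * I * μ * x)) * thetaProd τ z x

/-- The multiplier of `∏ θ(x - t_j)` with respect to the translation by `τ`. -/
noncomputable def tauFactor (τ : ℂ) (t : Fin n → ℂ) (x : ℂ) : ℂ :=
  (-1) ^ n * cexp (-(Real.pi * I * n * τ) - 2 * Real.pi * I * n * x) *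
    cexp (2 * Real.pi * I * ∑ j, t j)

lemma differentiable_thetaProd (hτ : 0 < τ.im) (t : Fin n → ℂ) :
    Differentiable ℂ (thetaProd τ t) := by
  have := differentiable_theta hτ
  unfold thetaProd
  refine Differentiable.fun_finsetProd fun j _ => ?_
  exact this.comp (f := fun x => x - t j) (by fun_prop)

lemma differentiable_twistedProd (hτ : 0 < τ.im) (μ : ℂ) (t : Fin n → ℂ) :
    Differentiable ℂ (twistedProd τ μ t) := by
  have := differentiable_thetaProd hτ t
  unfold twistedProd
  fun_prop

lemma thetaProd_ne_zero_iff {t : Fin n → ℂ} {x : ℂ} :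
    thetaProd τ t x ≠ 0 ↔ ∀ j, theta τ (x - t j) ≠ 0 := by
  simp [thetaProd, Finset.prod_ne_zero_iff]

lemma twistedProd_ne_zero_iff {μ : ℂ} {t : Fin n → ℂ} {x : ℂ} :
    twistedProd τ μ t x ≠ 0 ↔ ∀ j, theta τ (x - t j) ≠ 0 := by
  rw [← thetaProd_ne_zero_iff, twistedProd, mul_ne_zero_iff]
  simp [Complex.exp_ne_zero]

lemma thetaProd_add_one (t : Fin n → ℂ) (x : ℂ) :
    thetaProd τ t (x + 1) = (-1) ^ n * thetaProd τ t x := by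
  simp only [thetaProd, add_sub_right_comm, theta_add_one, Finset.prod_neg, Finset.card_univ,
    Fintype.card_fin]

lemma thetaProd_add_tau (hτ : 0 < τ.im) (t : Fin n → ℂ) (x : ℂ) :
    thetaProd τ t (x + τ) = tauFactor τ t x * thetaProd τ t x := by
  simp only [thetaProd, tauFactor, add_sub_right_comm, theta_add_tau hτ, Finset.prod_neg,
    Finset.card_univ, Fintype.card_fin, Finset.prod_mul_distrib, ← Complex.exp_sum, mul_assoc,
    ← Complex.exp_add]
  congr 3
  simp only [Finset.sum_sub_distrib, mul_sub, Finset.sum_neg_distrib, Finset.sum_const,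
    Finset.card_univ, Fintype.card_fin, nsmul_eq_mul, Finset.mul_sum]
  ring

lemma tauFactor_ne_zero (t : Fin n → ℂ) (x : ℂ) : tauFactor τ t x ≠ 0 := by
  simp [tauFactor, Complex.exp_ne_zero]

lemma differentiable_tauFactor (t : Fin n → ℂ) : Differentiable ℂ (tauFactor τ t) := by
  unfold tauFactor
  fun_prop

lemma tauFactor_add_one (t : Fin n → ℂ) (x : ℂ) :
    tauFactor τ t (x + 1) = tauFactor τ t x := by
  have : cexp (-(Real.pi * I * n * τ) - 2 * Real.pi * I * n * (x + 1)) =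
      cexp (-(Real.pi * I * n * τ) - 2 * Real.pi * I * n * x) := by
    refine Complex.exp_eq_exp_iff_exists_int.mpr ⟨-n, ?_⟩
    push_cast; ring
  rw [tauFactor, tauFactor, this]

lemma twistedProd_add_one (μ : ℂ) (z : Fin (2 * m) → ℂ) (x : ℂ) :
    twistedProd τ μ z (x + 1) =
      cexp (-(2 * Real.pi * I * μ)) * ((-1) ^ m) ^ 2 * twistedProd τ μ z x := by
  rw [twistedProd, twistedProd, thetaProd_add_one, mul_add, neg_add, Complex.exp_add, mul_one,
    ← pow_mul, mul_comm m 2]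
  ring

/-- The multiplier of the ratios with respect to the translation by `τ`. -/
noncomputable def tauMultiplier (τ μ : ℂ) (z : Fin (2 * m) → ℂ) (t : Fin m → ℂ) : ℂ :=
  cexp (2 * Real.pi * I * (∑ a, z a - 2 * ∑ j, t j - μ * τ))

/-- Twice as many z_a as t_j: the x-dependent exponentials of W and f² agree, so W/f² has a constant
multiplier. -/
lemma twistedProd_add_tau (hτ : 0 < τ.im) (μ : ℂ) (z : Fin (2 * m) → ℂ) (t : Fin m → ℂ) (x : ℂ) :
    twistedProd τ μ z (x + τ) =
      tauMultiplier τ μ z t * tauFactor τ t x ^ 2 * twistedProd τ μ z x := by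
  rw [twistedProd, twistedProd, thetaProd_add_tau hτ, tauMultiplier, tauFactor, tauFactor]
  have hs : ((-1 : ℂ) ^ m) ^ 2 = 1 := by rw [← pow_mul, mul_comm, pow_mul]; simp
  have hs' : (-1 : ℂ) ^ (2 * m) = 1 := by rw [pow_mul]; simp
  rw [hs', mul_pow, mul_pow, hs, one_mul, one_mul]
  have : ∀ a b c d e f y : ℂ, a + (b + c) = d + (2 * e + 2 * f) + y →
      cexp a * (cexp b * cexp c * thetaProd τ z x) =
      cexp d * (cexp e ^ 2 * cexp f ^ 2) * (cexp y * thetaProd τ z x) := by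
    intro a b c d e f y h
    have h' := congrArg cexp h
    have h2 : ∀ w : ℂ, cexp (2 * w) = cexp w ^ 2 := fun w => by
      rw [two_mul, Complex.exp_add, sq]
    simp only [Complex.exp_add, h2] at h'
    linear_combination h' * thetaProd τ z x
  apply this
  push_cast
  ring

/-- A solution of the Bethe ansatz equations. -/
def IsBethe (τ μ : ℂ) (z : Fin n → ℂ) (t : Fin m → ℂ) : Prop :=
  ∀ j, ∑ a, zetaFun τ (t j - z a) - 2 * ∑ k ∈ Finset.univ.erase j, zetaFun τ (t j - t k) =
    2 * Real.pi * I * μ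

/-- All zeros of `∏ θ(x - t_j)` are simple and are not zeros of `∏ θ(x - z_a)`. -/
structure IsGeneric (τ : ℂ) (z : Fin n → ℂ) (t : Fin m → ℂ) : Prop where
  left : ∀ j a, theta τ (t j - z a) ≠ 0
  right : ∀ j k, j ≠ k → theta τ (t j - t k) ≠ 0

lemma logDeriv_prod_theta (hτ : 0 < τ.im) (s : Finset (Fin n)) (t : Fin n → ℂ) (x : ℂ)
    (h : ∀ k ∈ s, theta τ (x - t k) ≠ 0) :
    logDeriv (fun x => ∏ k ∈ s, theta τ (x - t k)) x = ∑ k ∈ s, zetaFun τ (x - t k) := by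
  have hd := differentiable_theta hτ
  rw [logDeriv_prod (f := fun k x => theta τ (x - t k)) h
    (fun k _ => (hd.comp (f := fun x => x - t k) (by fun_prop)) x)]
  refine Finset.sum_congr rfl fun k _ => ?_
  rw [zetaFun, logDeriv_apply, logDeriv_apply, deriv_comp_sub_const]

lemma logDeriv_twistedProd (hτ : 0 < τ.im) {μ : ℂ} {z : Fin n → ℂ} {x : ℂ}
    (h : ∀ a, theta τ (x - z a) ≠ 0) :
    logDeriv (twistedProd τ μ z) x = -(2 * Real.pi * I * μ) + ∑ a, zetaFun τ (x - z a) := by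
  have h1 := logDeriv_prod_theta hτ Finset.univ z x (fun k _ => h k)
  have h2 : HasDerivAt (fun x => cexp (-(2 * Real.pi * I * μ * x)))
      (cexp (-(2 * Real.pi * I * μ * x)) * -(2 * Real.pi * I * μ)) x := by
    have := (((hasDerivAt_id x).const_mul (2 * Real.pi * I * μ)).neg).cexp
    simpa using this
  have h3 := logDeriv_mul (f := fun x => cexp (-(2 * Real.pi * I * μ * x)))
    (g := thetaProd τ z) x (Complex.exp_ne_zero _)
    (thetaProd_ne_zero_iff.mpr h) h2.differentiableAt (differentiable_thetaProd hτ z x)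
  unfold twistedProd
  rw [h3]
  congr 1
  rw [logDeriv_apply, h2.deriv, mul_div_cancel_left₀ _ (Complex.exp_ne_zero _)]

lemma deriv_deriv_theta_zero : deriv (deriv (theta τ)) 0 = 0 := by
  have := deriv_neg_of_even (deriv_neg_of_odd (theta_neg (τ := τ))) 0
  rw [neg_zero] at this
  exact self_eq_neg.mp this

lemma thetaProd_eq_mul (t : Fin n → ℂ) (j : Fin n) :
    thetaProd τ t = fun x => theta τ (x - t j) * ∏ k ∈ Finset.univ.erase j, theta τ (x - t k) :=
  funext fun _ => (Finset.mul_prod_erase _ _ (Finset.mem_univ j)).symm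

lemma thetaProd_self (t : Fin n → ℂ) (j : Fin n) : thetaProd τ t (t j) = 0 := by
  rw [thetaProd_eq_mul t j]
  simp [theta_zero]

lemma deriv_thetaProd_self (hτ : 0 < τ.im) (t : Fin n → ℂ) (j : Fin n) :
    deriv (thetaProd τ t) (t j) = ∏ k ∈ Finset.univ.erase j, theta τ (t j - t k) ∧
    deriv (deriv (thetaProd τ t)) (t j) =
      2 * deriv (fun x => ∏ k ∈ Finset.univ.erase j, theta τ (x - t k)) (t j) := by
  have hd := differentiable_theta hτ
  set p : ℂ → ℂ := fun x => ∏ k ∈ Finset.univ.erase j, theta τ (x - t k) with hp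
  have hpd : Differentiable ℂ p :=
    Differentiable.fun_finsetProd fun k _ => hd.comp (f := fun x => x - t k) (by fun_prop)
  have h1 : ∀ x, HasDerivAt (fun x => theta τ (x - t j)) (deriv (theta τ) (x - t j)) x :=
    fun x => (hd _).hasDerivAt.comp_sub_const x (t j)
  have h2 : ∀ x, HasDerivAt (fun x => deriv (theta τ) (x - t j))
      (deriv (deriv (theta τ)) (x - t j)) x :=
    fun x => (hd.deriv _).hasDerivAt.comp_sub_const x (t j)
  have h3 : deriv (thetaProd τ t) =
      fun x => deriv (theta τ) (x - t j) * p x + theta τ (x - t j) * deriv p x := by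
    rw [thetaProd_eq_mul t j]
    exact funext fun x => ((h1 x).fun_mul (hpd x).hasDerivAt).deriv
  rw [h3]
  constructor
  · simp [theta_zero, (hasDerivAt_theta_zero hτ).deriv, hp]
  · rw [(((h2 (t j)).fun_mul (hpd _).hasDerivAt).fun_add
      ((h1 (t j)).fun_mul (hpd.deriv _).hasDerivAt)).deriv]
    simp [theta_zero, (hasDerivAt_theta_zero hτ).deriv, deriv_deriv_theta_zero]
    ring

/-- The Bethe ansatz equations say that the local obstructions vanish at the points `t_j`. -/
lemma isBethe_iff (hτ : 0 < τ.im) {μ : ℂ} {z : Fin n → ℂ} {t : Fin m → ℂ}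
    (h : IsGeneric τ z t) : IsBethe τ μ z t ↔
      ∀ j, deriv (twistedProd τ μ z) (t j) * deriv (thetaProd τ t) (t j) =
        twistedProd τ μ z (t j) * deriv (deriv (thetaProd τ t)) (t j) := by
  refine forall_congr' fun j => ?_
  obtain ⟨h1, h2⟩ := deriv_thetaProd_self hτ t j
  have h3 := logDeriv_prod_theta hτ (Finset.univ.erase j) t (t j)
    (fun k hk => h.right _ _ (Finset.ne_of_mem_erase hk).symm)
  have h4 := logDeriv_twistedProd hτ (μ := μ) (h.left j)
  have h5 : twistedProd τ μ z (t j) ≠ 0 := twistedProd_ne_zero_iff.mpr (h.left j)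
  have h6 : ∏ k ∈ Finset.univ.erase j, theta τ (t j - t k) ≠ 0 :=
    Finset.prod_ne_zero_iff.mpr fun k hk => h.right _ _ (Finset.ne_of_mem_erase hk).symm
  rw [logDeriv_apply, div_eq_iff h6] at h3
  rw [logDeriv_apply, div_eq_iff h5] at h4
  rw [h1, h2, h3, h4]
  constructor
  · intro h7
    rw [← h7]
    ring
  · intro h7
    have h8 := mul_right_cancel₀ (b := twistedProd τ μ z (t j) *
      ∏ k ∈ Finset.univ.erase j, theta τ (t j - t k)) (mul_ne_zero h5 h6)
      (a := -(2 * Real.pi * I * μ) + ∑ a, zetaFun τ (t j - z a))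
      (c := 2 * ∑ k ∈ Finset.univ.erase j, zetaFun τ (t j - t k)) (by linear_combination h7)
    linear_combination h8

lemma deriv_shift {f f₁ E : ℂ → ℂ} {v : ℂ} (hf : Differentiable ℂ f) (hf₁ : Differentiable ℂ f₁)
    (hE : Differentiable ℂ E) (h : ∀ x, f (x + v) = E x * f₁ x) (x : ℂ) :
    deriv f (x + v) = deriv E x * f₁ x + E x * deriv f₁ x := by
  have h1 := (hf (x + v)).hasDerivAt.comp_add_const x v
  rw [funext h] at h1
  exact h1.unique ((hE x).hasDerivAt.fun_mul (hf₁ x).hasDerivAt)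

/-- At a zero of f the terms containing E' cancel, and W'f' - Wf'' is multiplied by κE³ ≠ 0. -/
lemma obstruction_shift_iff {f W E : ℂ → ℂ} {v κ : ℂ} (hf : Differentiable ℂ f)
    (hW : Differentiable ℂ W) (hE : Differentiable ℂ E) (hE0 : ∀ x, E x ≠ 0) (hκ : κ ≠ 0)
    (h : ∀ x, f (x + v) = E x * f x) (hWv : ∀ x, W (x + v) = κ * E x ^ 2 * W x) (x : ℂ) :
    (f (x + v) = 0 → deriv f (x + v) ≠ 0 ∧
      deriv W (x + v) * deriv f (x + v) = W (x + v) * deriv (deriv f) (x + v)) ↔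
    (f x = 0 → deriv f x ≠ 0 ∧ deriv W x * deriv f x = W x * deriv (deriv f) x) := by
  have hE2 : ∀ x, HasDerivAt (fun x => κ * E x ^ 2) (κ * (2 * E x * deriv E x)) x := fun x => by
    simpa using ((hE x).hasDerivAt.fun_pow 2).const_mul κ
  have h1 := deriv_shift hf hf hE h
  have h2 := deriv_shift hW hW (fun x => (hE2 x).differentiableAt) hWv x
  rw [(hE2 x).deriv] at h2
  have h3 : deriv (deriv f) (x + v) = deriv (deriv E) x * f x + deriv E x * deriv f x +
      (deriv E x * deriv f x + E x * deriv (deriv f) x) := by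
    have h4 := (hf.deriv (x + v)).hasDerivAt.comp_add_const x v
    rw [funext h1] at h4
    exact h4.unique (((hE.deriv x).hasDerivAt.fun_mul (hf x).hasDerivAt).fun_add
      ((hE x).hasDerivAt.fun_mul (hf.deriv x).hasDerivAt))
  have hx : f (x + v) = 0 ↔ f x = 0 := by rw [h, mul_eq_zero, or_iff_right (hE0 x)]
  rw [hx]
  refine forall_congr' fun h0 => ?_
  rw [h1, h2, h3, hWv, h0]
  have hne := hE0 x
  simp only [mul_zero, zero_add]
  rw [mul_ne_zero_iff, and_iff_right hne]
  refine and_congr_right fun _ => ⟨fun h5 => ?_, fun h5 => ?_⟩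
  · refine mul_left_cancel₀ (mul_ne_zero hκ (pow_ne_zero 3 hne)) ?_
    linear_combination h5
  · linear_combination κ * E x ^ 3 * h5

lemma tauMultiplier_ne_zero (μ : ℂ) (z : Fin (2 * m) → ℂ) (t : Fin m → ℂ) :
    tauMultiplier τ μ z t ≠ 0 := Complex.exp_ne_zero _

/-- The local obstructions vanish at all zeros of `∏ θ(x - t_j)` if they do at the `t_j`. -/
lemma obstruction_of_isBethe (hτ : 0 < τ.im) {μ : ℂ} {z : Fin (2 * m) → ℂ} {t : Fin m → ℂ}
    (h : IsGeneric τ z t) (hB : IsBethe τ μ z t) (x : ℂ) (hx : thetaProd τ t x = 0) :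
    deriv (thetaProd τ t) x ≠ 0 ∧ deriv (twistedProd τ μ z) x * deriv (thetaProd τ t) x =
      twistedProd τ μ z x * deriv (deriv (thetaProd τ t)) x := by
  obtain ⟨j, hj⟩ : ∃ j, theta τ (x - t j) = 0 := by
    by_contra! hne
    exact thetaProd_ne_zero_iff.mpr hne hx
  have hf := differentiable_thetaProd hτ t
  have hW := differentiable_twistedProd hτ μ z
  have key := iff_add_of_mem_lattice (τ := τ) (p := fun x => thetaProd τ t x = 0 →
      deriv (thetaProd τ t) x ≠ 0 ∧ deriv (twistedProd τ μ z) x * deriv (thetaProd τ t) x =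
      twistedProd τ μ z x * deriv (deriv (thetaProd τ t)) x)
    (obstruction_shift_iff (E := fun _ => (-1) ^ m) (κ := cexp (-(2 * Real.pi * I * μ))) hf hW
      (by fun_prop) (fun _ => by simp) (Complex.exp_ne_zero _) (thetaProd_add_one t)
      (twistedProd_add_one μ z))
    (obstruction_shift_iff hf hW (differentiable_tauFactor t) (tauFactor_ne_zero t)
      (tauMultiplier_ne_zero μ z t) (thetaProd_add_tau hτ t) (twistedProd_add_tau hτ μ z t))
    ((theta_eq_zero_iff hτ).mp hj) (t j)
  rw [add_sub_cancel] at key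
  refine key.mpr (fun _ => ⟨?_, (isBethe_iff hτ h).mp hB j⟩) hx
  rw [(deriv_thetaProd_self hτ t j).1]
  exact Finset.prod_ne_zero_iff.mpr fun k hk => h.right _ _ (Finset.ne_of_mem_erase hk).symm

end Products

/-! ### Ratios with the prescribed derivative correspond to Bethe solutions. -/

section Ratios

variable {τ w μ : ℂ} {m : ℕ} {z : Fin (2 * m) → ℂ} {t : Fin m → ℂ} {F : ℂ → ℂ}

lemma eventually_div_eq {f g : ℂ → ℂ} {s : ℂ} (hfs : f s = 0) :
    ∀ᶠ x in 𝓝[≠] s, g x / f x = (x - s) ^ (-1 : ℤ) • (g x / dslope f s x) := by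
  filter_upwards [self_mem_nhdsWithin] with x hx
  have := sub_smul_dslope f s x
  rw [hfs, sub_zero, smul_eq_mul] at this
  rw [← this, smul_eq_mul, zpow_neg_one]
  have : x - s ≠ 0 := sub_ne_zero.mpr hx
  field_simp

lemma differentiable_dslope {f : ℂ → ℂ} (hf : Differentiable ℂ f) (s : ℂ) :
    Differentiable ℂ (dslope f s) := by
  rw [← differentiableOn_univ]
  exact (Complex.differentiableOn_dslope Filter.univ_mem).mpr hf.differentiableOn

lemma meromorphicOrderAt_div_eq_neg_one_iff {f g : ℂ → ℂ} {s : ℂ} (hf : Differentiable ℂ f)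
    (hg : Differentiable ℂ g) (hfs : f s = 0) (hf' : deriv f s ≠ 0) :
    meromorphicOrderAt (fun x => g x / f x) s = -1 ↔ g s ≠ 0 := by
  have hmer : MeromorphicAt (fun x => g x / f x) s :=
    (hg.analyticAt s).meromorphicAt.fun_div (hf.analyticAt s).meromorphicAt
  have hfd := (differentiable_dslope hf s).analyticAt s
  have hne : dslope f s s ≠ 0 := by rwa [dslope_same]
  constructor
  · intro h hgs
    have h2 : (fun x => g x / f x) =ᶠ[𝓝[≠] s] fun x => dslope g s x / dslope f s x := by
      filter_upwards [self_mem_nhdsWithin] with x hx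
      have h1 := sub_smul_dslope f s x
      have h2 := sub_smul_dslope g s x
      rw [hfs, sub_zero, smul_eq_mul] at h1
      rw [hgs, sub_zero, smul_eq_mul] at h2
      rw [← h1, ← h2, mul_div_mul_left _ _ (sub_ne_zero.mpr hx)]
    rw [meromorphicOrderAt_congr h2] at h
    have h3 := (((differentiable_dslope hg s).analyticAt s).fun_div hfd
      hne).meromorphicOrderAt_nonneg
    rw [h] at h3
    exact absurd h3 (by decide)
  · intro hgs
    refine (meromorphicOrderAt_eq_int_iff hmer (n := -1)).mpr ⟨fun x => g x / dslope f s x,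
      (hg.analyticAt s).fun_div hfd hne, div_ne_zero hgs hne, eventually_div_eq hfs⟩

/-- The derivative of F is prescribed only off the poles; continuity extends the resulting Wronskian
identity across the isolated zeros of f. -/
lemma eq_of_forall_ne_zero {f a b : ℂ → ℂ} {s : ℂ} (hf : Differentiable ℂ f)
    (hf' : f s = 0 → deriv f s ≠ 0) (ha : Continuous a) (hb : Continuous b)
    (h : ∀ x, f x ≠ 0 → a x = b x) : a s = b s := by
  by_cases hs : f s = 0
  · have h1 := (hf s).hasDerivAt.eventually_ne (hf' hs) (c := 0)
    have h2 : a =ᶠ[𝓝[≠] s] b := h1.mono h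
    exact tendsto_nhds_unique_of_eventuallyEq (ha.continuousAt.continuousWithinAt)
      (hb.continuousAt.continuousWithinAt) h2
  · exact h s hs

lemma wronskian_eq_of_hasDerivAt {f g W : ℂ → ℂ} {c : ℂ} (hf : Differentiable ℂ f)
    (hg : Differentiable ℂ g)
    (h : ∀ x, f x ≠ 0 → HasDerivAt (fun x => g x / f x) (c * (W x / f x ^ 2)) x) (x : ℂ)
    (hx : f x ≠ 0) : deriv g x * f x - g x * deriv f x = c * W x := by
  have h1 := ((hg x).hasDerivAt.fun_div (hf x).hasDerivAt hx).unique (h x hx)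
  field_simp at h1
  exact h1

lemma hasThetaDerivative_iff : HasThetaDerivative τ m μ z t F ↔ ∃ c : ℂ, c ≠ 0 ∧
    ∀ x, thetaProd τ t x ≠ 0 →
      HasDerivAt F (c * (twistedProd τ μ z x / thetaProd τ t x ^ 2)) x := by
  simp only [HasThetaDerivative, thetaProd_ne_zero_iff]
  simp only [twistedProd, thetaProd, Finset.prod_pow]

lemma differentiable_wronskian {f g : ℂ → ℂ} (hf : Differentiable ℂ f)
    (hg : Differentiable ℂ g) : Differentiable ℂ fun x => deriv g x * f x - g x * deriv f x := by
  have := hf.deriv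
  have := hg.deriv
  fun_prop

/-- The poles of a ratio with the prescribed derivative solve the Bethe ansatz equations. -/
lemma isBethe_of_isThetaRatio (hτ : 0 < τ.im) (hF : IsThetaRatio τ w m t F)
    (hF' : HasThetaDerivative τ m μ z t F)
    (ht : ∀ j k, j ≠ k → theta τ (t j - t k) ≠ 0) : IsGeneric τ z t ∧ IsBethe τ μ z t := by
  obtain ⟨g, ⟨hg, -⟩, rfl⟩ := hF.eq_div
  obtain ⟨c, hc, hder⟩ := hasThetaDerivative_iff.mp hF'
  have hf := differentiable_thetaProd hτ t
  have hW := differentiable_twistedProd hτ μ z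
  have hsimple : ∀ j, deriv (thetaProd τ t) (t j) ≠ 0 := fun j => by
    rw [(deriv_thetaProd_self hτ t j).1]
    exact Finset.prod_ne_zero_iff.mpr fun k hk => ht _ _ (Finset.ne_of_mem_erase hk).symm
  have hwr := wronskian_eq_of_hasDerivAt hf hg hder
  have hpole : ∀ j, g (t j) ≠ 0 := fun j =>
    (meromorphicOrderAt_div_eq_neg_one_iff hf hg (thetaProd_self t j) (hsimple j)).mp
      (hF.simple_pole j)
  have hnear : ∀ j, (fun x => deriv g x * thetaProd τ t x - g x * deriv (thetaProd τ t) x)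
      =ᶠ[𝓝 (t j)] fun x => c * twistedProd τ μ z x := by
    intro j
    have h1 := (hf (t j)).hasDerivAt.eventually_ne (hsimple j) (c := 0)
    rw [eventually_nhdsWithin_iff] at h1
    filter_upwards [h1] with x hx
    by_cases hxj : x = t j
    · subst hxj
      exact eq_of_forall_ne_zero hf (fun _ => hsimple j) (differentiable_wronskian hf hg).continuous
        (hW.const_mul c).continuous hwr
    · exact hwr x (hx hxj)
  have hval : ∀ j, c * twistedProd τ μ z (t j) = -(g (t j) * deriv (thetaProd τ t) (t j)) := by
    intro j
    have := (hnear j).self_of_nhds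
    simp only [thetaProd_self] at this
    rw [← this]
    ring
  have hgen : IsGeneric τ z t := by
    refine ⟨fun j => ?_, ht⟩
    rw [← twistedProd_ne_zero_iff (μ := μ)]
    intro h0
    have := hval j
    rw [h0, mul_zero, eq_comm, neg_eq_zero] at this
    exact mul_ne_zero (hpole j) (hsimple j) this
  -- At t_j the Wronskian identity gives cW = -gf' and its derivative gives cW' = -gf''. Eliminating
  -- g yields W'f' = Wf''.
  refine ⟨hgen, (isBethe_iff hτ hgen).mpr fun j => ?_⟩
  have h1 := (hnear j).deriv_eq
  rw [((((hg.deriv (t j)).hasDerivAt.fun_mul (hf _).hasDerivAt)).fun_sub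
    ((hg _).hasDerivAt.fun_mul (hf.deriv _).hasDerivAt)).deriv,
    ((hW (t j)).hasDerivAt.const_mul c).deriv, thetaProd_self] at h1
  refine mul_left_cancel₀ hc ?_
  linear_combination -deriv (thetaProd τ t) (t j) * h1 -
    deriv (deriv (thetaProd τ t)) (t j) * hval j

lemma wronskian_shift {f g E : ℂ → ℂ} {v A : ℂ} (hf : Differentiable ℂ f)
    (hg : Differentiable ℂ g) (hE : Differentiable ℂ E) (hfv : ∀ x, f (x + v) = E x * f x)
    (hgv : ∀ x, g (x + v) = A * E x * g x) (x : ℂ) :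
    deriv g (x + v) * f (x + v) - g (x + v) * deriv f (x + v) =
      A * E x ^ 2 * (deriv g x * f x - g x * deriv f x) := by
  rw [deriv_shift hf hf hE hfv, deriv_shift hg hg (E := fun x => A * E x) (hE.const_mul A) hgv,
    hfv, hgv, ((hE x).hasDerivAt.const_mul A).deriv]
  ring

lemma multiplier_eq {f g W E : ℂ → ℂ} {v A κ c x₀ : ℂ} (hf : Differentiable ℂ f)
    (hg : Differentiable ℂ g) (hE : Differentiable ℂ E) (hE0 : ∀ x, E x ≠ 0)
    (hfv : ∀ x, f (x + v) = E x * f x)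
    (hgv : ∀ x, g (x + v) = A * E x * g x) (hWv : ∀ x, W (x + v) = κ * E x ^ 2 * W x)
    (h : ∀ x, deriv g x * f x - g x * deriv f x = c * W x) (hc : c ≠ 0) (hx : W x₀ ≠ 0) :
    A = κ := by
  have h1 := wronskian_shift hf hg hE hfv hgv x₀
  rw [h, h, hWv] at h1
  refine mul_right_cancel₀ (mul_ne_zero (mul_ne_zero hc (pow_ne_zero 2 (hE0 x₀))) hx) ?_
  linear_combination -h1

/-- Both g(x + v)/E(x) and κg solve the Wronskian equation with right-hand side κW, hence differ by
a multiple of f. -/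
lemma shift_of_wronskian_eq {f g W E : ℂ → ℂ} {v κ x₀ : ℂ} (hf : Differentiable ℂ f)
    (hg : Differentiable ℂ g) (hE : Differentiable ℂ E) (hE0 : ∀ x, E x ≠ 0)
    (hfv : ∀ x, f (x + v) = E x * f x) (hWv : ∀ x, W (x + v) = κ * E x ^ 2 * W x)
    (h : ∀ x, deriv g x * f x - g x * deriv f x = W x) (hx : f x₀ ≠ 0) :
    ∃ a, ∀ x, g (x + v) = E x * (κ * g x + a * f x) := by
  set h' : ℂ → ℂ := fun x => g (x + v) / E x with hh'
  have hh'd : Differentiable ℂ h' := (hg.comp (f := fun x => x + v) (by fun_prop)).fun_div hE hE0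
  have hgh : ∀ x, g (x + v) = E x * h' x := fun x => by rw [hh']; field_simp [hE0 x]
  have hwr : ∀ x, deriv h' x * f x - h' x * deriv f x = κ * W x := by
    intro x
    have h1 := h (x + v)
    rw [deriv_shift hf hf hE hfv, deriv_shift hg hh'd hE hgh, hfv, hgh, hWv] at h1
    refine mul_left_cancel₀ (pow_ne_zero 2 (hE0 x)) ?_
    linear_combination h1
  have := eq_smul_of_wronskian_eq_zero (U := Set.univ) isOpen_univ isPreconnected_univ
    (f := f) (d := fun x => h' x - κ * g x) hf.differentiableOn
    (hh'd.sub (hg.const_mul κ)).differentiableOn (Set.mem_univ x₀) hx (fun x _ => by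
      rw [((hh'd x).hasDerivAt.fun_sub ((hg x).hasDerivAt.const_mul κ)).deriv]
      linear_combination hwr x - κ * h x)
  refine ⟨(h' x₀ - κ * g x₀) / f x₀, fun x => ?_⟩
  rw [hgh, ← this x (Set.mem_univ x)]
  ring

lemma exists_thetaProd_ne_zero (hτ : 0 < τ.im) (ht : ∀ j k, j ≠ k → theta τ (t j - t k) ≠ 0)
    (hm : 0 < m) : ∃ x, thetaProd τ t x ≠ 0 := by
  by_contra! h
  have h1 : thetaProd τ t = fun _ => 0 := funext h
  have h2 := (deriv_thetaProd_self hτ t ⟨0, hm⟩).1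
  rw [h1, deriv_const] at h2
  exact Finset.prod_ne_zero_iff.mpr
    (fun k hk => ht _ _ (Finset.ne_of_mem_erase hk).symm) h2.symm

/-- The ratios with the poles `t_j` and with the prescribed derivative have a nontrivial multiplier
with respect to one of the two periods. -/
def HasNontrivialMultiplier (τ μ : ℂ) (z : Fin (2 * m) → ℂ) (t : Fin m → ℂ) : Prop :=
  ¬(cexp (-(2 * Real.pi * I * μ)) = 1 ∧ tauMultiplier τ μ z t = 1)

/-- The entire solution is quasi-periodic only up to additive multiples a, b of f under the two
translations. This pair is a cocycle of the lattice with values in a nontrivial character, hence a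
coboundary, and replacing g by g + kf removes it. -/
lemma exists_isThetaRatio (hτ : 0 < τ.im) (hm : 0 < m) (htw : ∀ j, t j ∈ parallelogram τ w)
    (hgen : IsGeneric τ z t) (hB : IsBethe τ μ z t) (hμ : HasNontrivialMultiplier τ μ z t) :
    ∃ F, IsThetaRatio τ w m t F ∧ HasThetaDerivative τ m μ z t F := by
  have hf := differentiable_thetaProd hτ t
  have hW := differentiable_twistedProd hτ μ z
  obtain ⟨x₀, hx₀⟩ := exists_thetaProd_ne_zero hτ hgen.right hm
  have hobs := obstruction_of_isBethe hτ hgen hB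
  obtain ⟨g₀, hg₀, hgW₀⟩ := exists_wronskian_eq hf hW hobs
  obtain ⟨a, ha⟩ := shift_of_wronskian_eq (E := fun _ => (-1) ^ m) hf hg₀ (by fun_prop)
    (fun _ => by simp) (thetaProd_add_one t) (twistedProd_add_one μ z) hgW₀ hx₀
  obtain ⟨b, hb⟩ := shift_of_wronskian_eq hf hg₀ (differentiable_tauFactor t)
    (tauFactor_ne_zero t) (thetaProd_add_tau hτ t) (twistedProd_add_tau hτ μ z t) hgW₀ hx₀
  set α := cexp (-(2 * Real.pi * I * μ)) with hα
  set β := tauMultiplier τ μ z t with hβ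
  -- Evaluate the solution at x₀ + 1 + τ in both orders.
  have hcomm : a * (β - 1) = b * (α - 1) := by
    have h1 := hb (x₀ + 1)
    have h2 := ha (x₀ + τ)
    rw [ha, thetaProd_add_one, tauFactor_add_one, add_right_comm] at h1
    rw [hb, thetaProd_add_tau hτ] at h2
    rw [h1] at h2
    refine mul_left_cancel₀ (mul_ne_zero (mul_ne_zero (tauFactor_ne_zero (τ := τ) t x₀)
      (pow_ne_zero m (neg_ne_zero.mpr one_ne_zero))) hx₀) ?_
    linear_combination h2
  obtain ⟨k, hka, hkb⟩ : ∃ k, a = k * (α - 1) ∧ b = k * (β - 1) := by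
    by_cases h1 : α = 1
    · have h2 : β - 1 ≠ 0 := sub_ne_zero.mpr fun h2 => hμ ⟨h1, h2⟩
      refine ⟨b / (β - 1), ?_, by field_simp⟩
      refine mul_right_cancel₀ h2 ?_
      rw [hcomm]
      field_simp
    · have h2 : α - 1 ≠ 0 := sub_ne_zero.mpr h1
      refine ⟨a / (α - 1), by field_simp, ?_⟩
      refine mul_right_cancel₀ h2 ?_
      rw [← hcomm]
      field_simp
  set g : ℂ → ℂ := fun x => g₀ x + k * thetaProd τ t x with hgdef
  have hg : Differentiable ℂ g := hg₀.add (hf.const_mul k)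
  have hgW : ∀ x, deriv g x * thetaProd τ t x - g x * deriv (thetaProd τ t) x =
      twistedProd τ μ z x := by
    intro x
    rw [hgdef, ((hg₀ x).hasDerivAt.fun_add ((hf x).hasDerivAt.const_mul k)).deriv, ← hgW₀]
    ring
  refine ⟨fun x => g x / thetaProd τ t x, ⟨htw, ?_, ⟨g, ⟨hg, α,
    cexp (2 * Real.pi * I * ∑ j, t j) * β, Complex.exp_ne_zero _,
    mul_ne_zero (Complex.exp_ne_zero _) (tauMultiplier_ne_zero μ z t), ?_, ?_⟩, rfl⟩, ?_⟩, ?_⟩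
  · intro j k hjk
    by_contra hne
    refine hgen.right j k hne ?_
    rw [hjk, sub_self, theta_zero]
  · intro x
    simp only [hgdef, ha, thetaProd_add_one, hka]
    ring
  · intro x
    simp only [hgdef, hb, thetaProd_add_tau hτ, hkb, tauFactor]
    ring
  · intro j
    have hd := hobs (t j) (thetaProd_self t j)
    refine (meromorphicOrderAt_div_eq_neg_one_iff hf hg (thetaProd_self t j) hd.1).mpr fun h0 => ?_
    have h1 := hgW (t j)
    rw [h0, thetaProd_self, mul_zero, zero_mul, sub_zero] at h1
    exact twistedProd_ne_zero_iff.mpr (hgen.left j) h1.symm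
  · refine hasThetaDerivative_iff.mpr ⟨1, one_ne_zero, fun x hx => ?_⟩
    rw [one_mul, ← hgW]
    exact (hg x).hasDerivAt.fun_div (hf x).hasDerivAt hx

lemma exists_eq_smul_of_isThetaRatio (hτ : 0 < τ.im) (hm : 0 < m) {F₁ F₂ : ℂ → ℂ}
    (h₁ : IsThetaRatio τ w m t F₁) (h₁' : HasThetaDerivative τ m μ z t F₁)
    (h₂ : IsThetaRatio τ w m t F₂) (h₂' : HasThetaDerivative τ m μ z t F₂)
    (hgen : IsGeneric τ z t) (hB : IsBethe τ μ z t) (hμ : HasNontrivialMultiplier τ μ z t) :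
    ∃ c : ℂ, c ≠ 0 ∧ F₁ = fun x => c * F₂ x := by
  have hf := differentiable_thetaProd hτ t
  have hW := differentiable_twistedProd hτ μ z
  obtain ⟨x₀, hx₀⟩ := exists_thetaProd_ne_zero hτ hgen.right hm
  have hWt : twistedProd τ μ z (t ⟨0, hm⟩) ≠ 0 := twistedProd_ne_zero_iff.mpr (hgen.left _)
  have hobs := obstruction_of_isBethe hτ hgen hB
  have key : ∀ F, IsThetaRatio τ w m t F → HasThetaDerivative τ m μ z t F →
      ∃ g : ℂ → ℂ, ∃ c : ℂ, c ≠ 0 ∧ Differentiable ℂ g ∧ F = (fun x => g x / thetaProd τ t x) ∧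
      (∀ x, deriv g x * thetaProd τ t x - g x * deriv (thetaProd τ t) x =
        c * twistedProd τ μ z x) ∧
      (∀ x, g (x + 1) = cexp (-(2 * Real.pi * I * μ)) * (-1) ^ m * g x) ∧
      ∀ x, g (x + τ) = tauMultiplier τ μ z t * tauFactor τ t x * g x := by
    rintro F hF hF'
    obtain ⟨g, ⟨hg, A, B, hA, hB, h1, h2⟩, rfl⟩ := hF.eq_div
    obtain ⟨c, hc, hder⟩ := hasThetaDerivative_iff.mp hF'
    have hwr : ∀ x, deriv g x * thetaProd τ t x - g x * deriv (thetaProd τ t) x =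
        c * twistedProd τ μ z x := fun x =>
      eq_of_forall_ne_zero hf (fun h => (hobs x h).1) (differentiable_wronskian hf hg).continuous
        (hW.const_mul c).continuous (wronskian_eq_of_hasDerivAt hf hg hder)
    have hA' := multiplier_eq (E := fun _ => (-1) ^ m) hf hg (by fun_prop) (fun _ => by simp)
      (thetaProd_add_one t) h1 (twistedProd_add_one μ z) hwr hc hWt
    have h3 : ∀ x, g (x + τ) = B / cexp (2 * Real.pi * I * ∑ j, t j) * tauFactor τ t x * g x := by
      intro x
      rw [h2, tauFactor]
      have := Complex.exp_ne_zero (2 * Real.pi * I * ∑ j, t j)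
      field_simp
    have hB' := multiplier_eq hf hg (differentiable_tauFactor t) (tauFactor_ne_zero t)
      (thetaProd_add_tau hτ t) h3 (twistedProd_add_tau hτ μ z t) hwr hc hWt
    refine ⟨g, c, hc, hg, rfl, hwr, ?_, ?_⟩
    · rwa [← hA']
    · rwa [← hB']
  obtain ⟨g₁, c₁, hc₁, hg₁, rfl, hw₁, ha₁, hb₁⟩ := key F₁ h₁ h₁'
  obtain ⟨g₂, c₂, hc₂, hg₂, rfl, hw₂, ha₂, hb₂⟩ := key F₂ h₂ h₂'
  have hd := eq_smul_of_wronskian_eq_zero (U := Set.univ) isOpen_univ isPreconnected_univ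
    (f := thetaProd τ t) (d := fun x => c₂ * g₁ x - c₁ * g₂ x) hf.differentiableOn
    ((hg₁.const_mul c₂).sub (hg₂.const_mul c₁)).differentiableOn (Set.mem_univ x₀) hx₀
    (fun x _ => by
      rw [(((hg₁ x).hasDerivAt.const_mul c₂).fun_sub ((hg₂ x).hasDerivAt.const_mul c₁)).deriv]
      linear_combination c₂ * hw₁ x - c₁ * hw₂ x)
  set k := (c₂ * g₁ x₀ - c₁ * g₂ x₀) / thetaProd τ t x₀ with hk
  -- The difference of the rescaled solutions has the multipliers of g, while kf has those of f; k ≠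
  -- 0 would force both relative multipliers to be 1.
  have hk0 : k = 0 := by
    by_contra hk0
    refine hμ ⟨?_, ?_⟩
    · have h1 := hd (x₀ + 1) (Set.mem_univ _)
      have h0 := hd x₀ (Set.mem_univ _)
      simp only [ha₁, ha₂, thetaProd_add_one] at h1
      refine mul_right_cancel₀ (mul_ne_zero (mul_ne_zero hk0 hx₀)
        (pow_ne_zero m (neg_ne_zero.mpr one_ne_zero))) ?_
      linear_combination h1 - cexp (-(2 * Real.pi * I * μ)) * (-1) ^ m * h0
    · have h1 := hd (x₀ + τ) (Set.mem_univ _)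
      have h0 := hd x₀ (Set.mem_univ _)
      simp only [hb₁, hb₂, thetaProd_add_tau hτ] at h1
      refine mul_right_cancel₀ (mul_ne_zero (mul_ne_zero hk0 hx₀)
        (tauFactor_ne_zero (τ := τ) t x₀)) ?_
      linear_combination h1 - tauMultiplier τ μ z t * tauFactor τ t x₀ * h0
  refine ⟨c₁ / c₂, div_ne_zero hc₁ hc₂, funext fun x => ?_⟩
  have := hd x (Set.mem_univ _)
  simp only [hk0, zero_mul, sub_eq_zero] at this
  have h3 : g₁ x = c₁ / c₂ * g₂ x := by
    field_simp
    rw [← this, mul_comm]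
  rw [h3, mul_div_assoc]

lemma thetaProd_comp_perm (t : Fin m → ℂ) (σ : Equiv.Perm (Fin m)) :
    thetaProd τ (t ∘ σ) = thetaProd τ t :=
  funext fun x => Equiv.prod_comp σ fun j => theta τ (x - t j)

lemma IsThetaRatio.comp_perm (h : IsThetaRatio τ w m t F) (σ : Equiv.Perm (Fin m)) :
    IsThetaRatio τ w m (t ∘ σ) F := by
  refine ⟨fun j => h.mem_parallelogram _, h.injective.comp σ.injective, ?_,
    fun j => h.simple_pole _⟩
  obtain ⟨g, hg, hF⟩ := h.eq_div
  refine ⟨g, hg, hF.trans (funext fun x => ?_)⟩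
  exact congrArg (g x / ·) (congrFun (thetaProd_comp_perm t σ).symm x)

lemma HasThetaDerivative.comp_perm (h : HasThetaDerivative τ m μ z t F)
    (σ : Equiv.Perm (Fin m)) : HasThetaDerivative τ m μ z (t ∘ σ) F := by
  rw [hasThetaDerivative_iff] at h ⊢
  simpa only [thetaProd_comp_perm] using h

end Ratios

/-! ### Small solutions of a system with large right-hand side, by contraction. -/

section SmallSolutions

variable {ι : Type*} [Fintype ι]

/-- The system `1 / s_j + H_j(s) = M` has a unique small solution for large `M`. -/
lemma existsUnique_small_solution {H : (ι → ℂ) → ι → ℂ} {r : ℝ} {K : NNReal}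
    (hr : 0 < r) (hH : LipschitzOnWith K H (Metric.closedBall 0 r)) :
    ∃ N : ℝ, ∀ M : ℂ, N < ‖M‖ →
      ∃! s : ι → ℂ, s ∈ Metric.closedBall 0 r ∧ ∀ j, s j ≠ 0 ∧ 1 / s j + H s j = M := by
  set C : ℝ := ‖H 0‖ + K * r with hC
  have hC0 : 0 ≤ C := by positivity
  -- C bounds H on the ball, so |M - H_j| ≥ D = 1/r + 2K + 1. The part 1/r keeps the map s ↦ (M -
  -- H(s))⁻¹ inside the ball; D ≥ 1 and D ≥ 2K give D² ≥ 2K, hence Lipschitz constant 1/2.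
  refine ⟨C + 1 / r + 2 * K + 1, fun M hM => ?_⟩
  have hr' : 0 < 1 / r := by positivity
  have hK : (0 : ℝ) ≤ K := K.coe_nonneg
  have hbound : ∀ s ∈ Metric.closedBall (0 : ι → ℂ) r, ∀ j, ‖H s j‖ ≤ C := by
    intro s hs j
    have h1 := hH.norm_sub_le hs (Metric.mem_closedBall_self hr.le)
    have h2 := norm_le_pi_norm (H s) j
    have h3 : ‖s - 0‖ ≤ r := by simpa using hs
    have h4 := norm_le_norm_add_norm_sub (H 0) (H s)
    rw [norm_sub_rev] at h4
    have h5 : K * ‖s - 0‖ ≤ K * r := mul_le_mul_of_nonneg_left h3 hK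
    linarith
  set D : ℝ := 1 / r + 2 * K + 1 with hD
  have hD1 : 1 ≤ D := by linarith
  have hlow : ∀ s ∈ Metric.closedBall (0 : ι → ℂ) r, ∀ j, D ≤ ‖M - H s j‖ := by
    intro s hs j
    have h1 := hbound s hs j
    have h2 := norm_sub_norm_le M (H s j)
    linarith
  have hne : ∀ s ∈ Metric.closedBall (0 : ι → ℂ) r, ∀ j, M - H s j ≠ 0 := fun s hs j =>
    norm_pos_iff.mp (by linarith [hlow s hs j])
  set T : (ι → ℂ) → ι → ℂ := fun s j => (M - H s j)⁻¹ with hT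
  have hmaps : Set.MapsTo T (Metric.closedBall 0 r) (Metric.closedBall 0 r) := by
    intro s hs
    rw [mem_closedBall_zero_iff, pi_norm_le_iff_of_nonneg hr.le]
    intro j
    rw [hT, norm_inv]
    refine inv_le_of_inv_le₀ hr ?_
    rw [← one_div]
    linarith [hlow s hs j]
  have hcontr : ∀ x ∈ Metric.closedBall (0 : ι → ℂ) r, ∀ y ∈ Metric.closedBall (0 : ι → ℂ) r,
      dist (T x) (T y) ≤ (1 / 2 : NNReal) * dist x y := by
    intro x hx y hy
    rw [dist_pi_le_iff (by positivity)]
    intro j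
    have h1 : T x j - T y j = (H x j - H y j) / ((M - H x j) * (M - H y j)) := by
      have := hne x hx j
      have := hne y hy j
      simp only [hT]
      field_simp
      ring
    rw [dist_eq_norm, h1, norm_div, norm_mul, div_le_iff₀ (mul_pos
      (norm_pos_iff.mpr (hne x hx j)) (norm_pos_iff.mpr (hne y hy j)))]
    have h2 : ‖H x j - H y j‖ ≤ K * dist x y := by
      refine (norm_le_pi_norm (H x - H y) j).trans ?_
      rw [dist_eq_norm]
      exact hH.norm_sub_le hx hy
    have h3 : 2 * (K : ℝ) ≤ ‖M - H x j‖ * ‖M - H y j‖ := by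
      have := mul_le_mul (hlow x hx j) (hlow y hy j) (by linarith) (norm_nonneg _)
      nlinarith
    have h4 : (0 : ℝ) ≤ dist x y := dist_nonneg
    have h5 : (((1 / 2 : NNReal)) : ℝ) = 1 / 2 := by norm_num
    rw [h5]
    nlinarith
  have hcw : ContractingWith (1 / 2) (hmaps.restrict T _ _) := by
    refine ⟨by rw [← NNReal.coe_lt_coe]; norm_num, LipschitzWith.of_dist_le_mul fun x y => ?_⟩
    exact hcontr x x.2 y y.2
  obtain ⟨s, hs, hfix, -, -⟩ := hcw.exists_fixedPoint'
    (Metric.isClosed_closedBall.isComplete) hmaps (Metric.mem_closedBall_self hr.le)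
    (edist_ne_top _ _)
  have hiff : ∀ s ∈ Metric.closedBall (0 : ι → ℂ) r,
      (∀ j, s j ≠ 0 ∧ 1 / s j + H s j = M) ↔ T s = s := by
    intro s hs
    rw [funext_iff]
    refine forall_congr' fun j => ?_
    have hj := hne s hs j
    simp only [hT]
    constructor
    · rintro ⟨h1, h2⟩
      rw [← h2]
      simp
    · intro h
      rw [← h]
      exact ⟨inv_ne_zero hj, by rw [h]; simp [← h]⟩
  refine ⟨s, ⟨hs, (hiff s hs).mpr hfix⟩, fun s' ⟨hs', h'⟩ => ?_⟩
  have h1 := (hiff s' hs').mp h'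
  have h2 := hcontr s' hs' s hs
  rw [h1, hfix.eq] at h2
  have h5 : (((1 / 2 : NNReal)) : ℝ) = 1 / 2 := by norm_num
  rw [h5] at h2
  exact dist_le_zero.mp (by linarith)

end SmallSolutions

/-! ### Several points cannot cluster at the same pole. -/

section Cluster

variable {ι : Type*}

lemma sum_sum_eq_zero_of_antisymm (C : Finset ι) {f : ι → ι → ℂ} (hf : ∀ i j, f i j = -f j i) :
    ∑ i ∈ C, ∑ j ∈ C, f i j = 0 := by
  have h : ∑ i ∈ C, ∑ j ∈ C, f i j = -∑ i ∈ C, ∑ j ∈ C, f i j := by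
    conv_lhs => rw [Finset.sum_comm]
    simp only [← Finset.sum_neg_distrib]
    exact Finset.sum_congr rfl fun i _ => Finset.sum_congr rfl fun j _ => hf j i
  exact self_eq_neg.mp h

/-- Symmetrize in j and l: 1/(s_j(s_j - s_l)) + 1/(s_l(s_l - s_j)) = -1/(s_j s_l). The diagonal
terms on the left are 0 because 0⁻¹ = 0, which accounts for the sum of squares. -/
lemma sum_inv_mul_inv_sub (C : Finset ι) {s : ι → ℂ} (hs0 : ∀ j ∈ C, s j ≠ 0)
    (hs : ∀ j ∈ C, ∀ l ∈ C, j ≠ l → s j ≠ s l) :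
    ∑ j ∈ C, ∑ l ∈ C, 2 * ((s j)⁻¹ * (s j - s l)⁻¹) =
      ∑ j ∈ C, ((s j)⁻¹) ^ 2 - (∑ j ∈ C, (s j)⁻¹) ^ 2 := by
  classical
  have h1 : ∑ j ∈ C, ∑ l ∈ C, 2 * ((s j)⁻¹ * (s j - s l)⁻¹) =
      ∑ j ∈ C, ∑ l ∈ C, ((s j)⁻¹ * (s j - s l)⁻¹ + (s l)⁻¹ * (s l - s j)⁻¹) := by
    simp only [Finset.sum_add_distrib, two_mul]
    congr 1
    exact Finset.sum_comm
  have h2 : ∀ j ∈ C, ∀ l ∈ C, (s j)⁻¹ * (s j - s l)⁻¹ + (s l)⁻¹ * (s l - s j)⁻¹ =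
      (if j = l then ((s j)⁻¹) ^ 2 else 0) - (s j)⁻¹ * (s l)⁻¹ := by
    intro j hj l hl
    split_ifs with hjl
    · subst hjl
      simp [sq]
    · have h3 := hs0 j hj
      have h4 := hs0 l hl
      have h5 := sub_ne_zero.mpr (hs j hj l hl hjl)
      have h6 := sub_ne_zero.mpr (hs l hl j hj (Ne.symm hjl))
      field_simp
      ring
  rw [h1, Finset.sum_congr rfl fun j hj => Finset.sum_congr rfl (h2 j hj)]
  simp only [Finset.sum_sub_distrib, Finset.sum_ite_eq, sq (∑ j ∈ C, (s j)⁻¹), Finset.sum_mul_sum]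
  congr 1
  exact Finset.sum_congr rfl fun j hj => if_pos hj

/-- A cluster of `k` solutions of a perturbation of `M = 1 / s_j - 2 ∑ 1 / (s_j - s_l)` satisfies
a perturbation of `k M (k - 1) M = 0`. -/
lemma cluster_identity (C : Finset ι) {s : ι → ℂ} {φ h : ℂ → ℂ} {K ρ : ℝ} {M : ℂ}
    (hodd : ∀ x, φ (-x) = -φ x)
    (hφ : ∀ x ∈ Metric.ball 0 ρ, ∀ y ∈ Metric.ball 0 ρ, ‖φ x - φ y‖ ≤ K * ‖x - y‖)
    (hh : ∀ x ∈ Metric.ball 0 ρ, ∀ y ∈ Metric.ball 0 ρ, ‖h x - h y‖ ≤ K * ‖x - y‖)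
    (hh0 : ‖h 0‖ ≤ K) (hs0 : ∀ j ∈ C, s j ≠ 0) (hs : ∀ j ∈ C, ∀ l ∈ C, j ≠ l → s j ≠ s l)
    (hρ : ∀ j ∈ C, ‖s j‖ < ρ / 2)
    (hM : ∀ j ∈ C, (s j)⁻¹ - 2 * ∑ l ∈ C, ((s j - s l)⁻¹ + φ (s j - s l)) + h (s j) = M) :
    ∃ η ξ E : ℂ, ‖η‖ ≤ C.card * (K + K * ρ) ∧
      ‖ξ‖ ≤ C.card * (K + K * ρ) + (K + 2 * (C.card * (K * ρ))) ∧
      ‖E‖ ≤ C.card * K + 2 * (C.card * (C.card * K)) ∧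
      (C.card * M - η) * ((C.card - 1) * M + ξ) = E := by
  have hK : 0 ≤ K := (norm_nonneg _).trans hh0
  have hφ0 : φ 0 = 0 := by
    have := hodd 0
    rw [neg_zero] at this
    exact self_eq_neg.mp this
  have hb : ∀ j ∈ C, s j ∈ Metric.ball 0 ρ := fun j hj => by
    rw [mem_ball_zero_iff]
    linarith [hρ j hj, norm_nonneg (s j)]
  have hb' : ∀ j ∈ C, -s j ∈ Metric.ball 0 ρ := fun j hj => by
    rw [mem_ball_zero_iff, norm_neg]
    exact mem_ball_zero_iff.mp (hb j hj)
  have hb0 : ∀ j ∈ C, (0 : ℂ) ∈ Metric.ball 0 ρ := fun j hj => Metric.mem_ball_self (by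
    linarith [hρ j hj, norm_nonneg (s j)])
  have hbd : ∀ j ∈ C, ∀ l ∈ C, s j - s l ∈ Metric.ball 0 ρ := fun j hj l hl => by
    rw [mem_ball_zero_iff]
    linarith [hρ j hj, hρ l hl, norm_sub_le (s j) (s l)]
  have hle : ∀ j ∈ C, K * ‖s j‖ ≤ K * ρ := fun j hj =>
    mul_le_mul_of_nonneg_left (mem_ball_zero_iff.mp (hb j hj)).le hK
  set S := ∑ j ∈ C, (s j)⁻¹ with hS
  set Φ := ∑ j ∈ C, φ (s j) with hΦ
  set η := ∑ j ∈ C, h (s j) with hη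
  -- The errors `e` and `e₂` remain bounded although s_j⁻¹ is large: in each, the two arguments of
  -- the Lipschitz function differ by exactly s_j.
  set e : ι → ℂ := fun j => (h (s j) - h 0) * (s j)⁻¹ with he
  set e₂ : ι → ι → ℂ := fun j l => (φ (s j - s l) - φ (-s l)) * (s j)⁻¹ with he₂
  have hηb : ‖η‖ ≤ C.card * (K + K * ρ) := by
    rw [← nsmul_eq_mul]
    refine norm_sum_le_of_le _ (fun j hj => ?_) |>.trans (by rw [Finset.sum_const])
    have h1 := hh _ (hb j hj) 0 (hb0 j hj)
    rw [sub_zero] at h1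
    have h2 := norm_le_norm_add_norm_sub (h 0) (h (s j))
    rw [norm_sub_rev] at h2
    linarith [hle j hj]
  have hΦb : ‖Φ‖ ≤ C.card * (K * ρ) := by
    rw [← nsmul_eq_mul]
    refine norm_sum_le_of_le _ (fun j hj => ?_) |>.trans (by rw [Finset.sum_const])
    have h1 := hφ _ (hb j hj) 0 (hb0 j hj)
    rw [hφ0, sub_zero, sub_zero] at h1
    linarith [hle j hj]
  have heb : ‖∑ j ∈ C, e j‖ ≤ C.card * K := by
    rw [← nsmul_eq_mul]
    refine norm_sum_le_of_le _ (fun j hj => ?_) |>.trans (by rw [Finset.sum_const])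
    have h1 := hh _ (hb j hj) 0 (hb0 j hj)
    rw [sub_zero] at h1
    rw [he, norm_mul, norm_inv, ← div_eq_mul_inv, div_le_iff₀ (norm_pos_iff.mpr (hs0 j hj))]
    exact h1
  have he₂b : ‖∑ j ∈ C, ∑ l ∈ C, e₂ j l‖ ≤ C.card * (C.card * K) := by
    rw [← nsmul_eq_mul, ← nsmul_eq_mul]
    refine norm_sum_le_of_le _ (fun j hj => ?_) |>.trans (by rw [Finset.sum_const])
    refine norm_sum_le_of_le _ (fun l hl => ?_) |>.trans (by rw [Finset.sum_const])
    have h1 := hφ _ (hbd j hj l hl) _ (hb' l hl)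
    rw [sub_neg_eq_add, sub_add_cancel] at h1
    rw [he₂, norm_mul, norm_inv, ← div_eq_mul_inv, div_le_iff₀ (norm_pos_iff.mpr (hs0 j hj))]
    exact h1
  -- Sum of the equations; the pair interactions are antisymmetric and cancel.
  have hsum : C.card * M = S + η := by
    have h1 : ∑ j ∈ C, M = C.card * M := by simp
    rw [← h1, ← Finset.sum_congr rfl hM, Finset.sum_add_distrib, Finset.sum_sub_distrib,
      ← Finset.mul_sum, sum_sum_eq_zero_of_antisymm]
    · ring
    · intro j l
      rw [← neg_sub (s j) (s l), hodd, inv_neg]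
      ring
  -- Sum of the equations multiplied by s_j⁻¹.
  have hsum₂ : M * S = S ^ 2 + h 0 * S + ∑ j ∈ C, e j + 2 * (Φ * S) -
      2 * ∑ j ∈ C, ∑ l ∈ C, e₂ j l := by
    have h1 : M * S = ∑ j ∈ C, ((s j)⁻¹ - 2 * ∑ l ∈ C, ((s j - s l)⁻¹ + φ (s j - s l)) +
        h (s j)) * (s j)⁻¹ := by
      rw [hS, Finset.mul_sum]
      exact Finset.sum_congr rfl fun j hj => by rw [hM j hj]
    have h2 : ∀ j ∈ C, ((s j)⁻¹ - 2 * ∑ l ∈ C, ((s j - s l)⁻¹ + φ (s j - s l)) +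
        h (s j)) * (s j)⁻¹ = ((s j)⁻¹) ^ 2 - ∑ l ∈ C, 2 * ((s j)⁻¹ * (s j - s l)⁻¹) -
        2 * ∑ l ∈ C, e₂ j l + 2 * ∑ l ∈ C, φ (s l) * (s j)⁻¹ + e j + h 0 * (s j)⁻¹ := by
      intro j hj
      have h3 : ∑ l ∈ C, e₂ j l = (∑ l ∈ C, φ (s j - s l)) * (s j)⁻¹ +
          ∑ l ∈ C, φ (s l) * (s j)⁻¹ := by
        rw [Finset.sum_mul, ← Finset.sum_add_distrib]
        refine Finset.sum_congr rfl fun l _ => ?_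
        simp only [he₂, hodd]
        ring
      rw [h3, ← Finset.mul_sum, ← Finset.mul_sum, Finset.sum_add_distrib]
      simp only [he]
      ring
    rw [h1, Finset.sum_congr rfl h2]
    simp only [Finset.sum_add_distrib, Finset.sum_sub_distrib, ← Finset.mul_sum, ← Finset.sum_mul]
    have h4 := sum_inv_mul_inv_sub C hs0 hs
    simp only [← Finset.mul_sum] at h4
    rw [h4, ← hS, ← hΦ]
    ring
  -- The second sum reads S(S - M + h(0) + 2Φ) = E; substitute S = kM - η from the first, where k is
  -- the number of points.
  refine ⟨η, -η + (h 0 + 2 * Φ), -∑ j ∈ C, e j + 2 * ∑ j ∈ C, ∑ l ∈ C, e₂ j l, hηb, ?_, ?_, ?_⟩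
  · refine (norm_add_le _ _).trans (add_le_add (by rwa [norm_neg])
      ((norm_add_le _ _).trans (add_le_add hh0 ?_)))
    rw [norm_mul, Complex.norm_ofNat]
    linarith
  · refine (norm_add_le _ _).trans (add_le_add (by rwa [norm_neg]) ?_)
    rw [norm_mul, Complex.norm_ofNat]
    linarith
  · linear_combination (((C.card : ℂ) - 1) * M - η + h 0 + 2 * Φ) * hsum +
      S * hsum - hsum₂

lemma tendsto_div_zero_of_norm_le {M x : ℕ → ℂ} {B : ℝ} (hM : Tendsto (fun n => ‖M n‖) atTop atTop)
    (hx : ∀ᶠ n in atTop, ‖x n‖ ≤ B) : Tendsto (fun n => x n / M n) atTop (𝓝 0) := by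
  rw [tendsto_zero_iff_norm_tendsto_zero]
  have h1 : Tendsto (fun n => B / ‖M n‖) atTop (𝓝 0) := hM.const_div_atTop B
  refine squeeze_zero' (.of_forall fun n => norm_nonneg _) ?_ h1
  filter_upwards [hx] with n hn
  rw [norm_div]
  gcongr

/-- A family of functions which is Lipschitz near `0` and bounded at `0`, uniformly for large
values of the parameter. -/
def EventuallyLipschitz (f : ℕ → ℂ → ℂ) : Prop :=
  ∃ ρ > 0, ∃ K : ℝ, ∀ᶠ n in atTop, (∀ x ∈ Metric.ball 0 ρ, ∀ y ∈ Metric.ball 0 ρ,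
    ‖f n x - f n y‖ ≤ K * ‖x - y‖) ∧ ‖f n 0‖ ≤ K

lemma EventuallyLipschitz.add {f g : ℕ → ℂ → ℂ} (hf : EventuallyLipschitz f)
    (hg : EventuallyLipschitz g) : EventuallyLipschitz fun n x => f n x + g n x := by
  obtain ⟨ρ, hρ, K, hK⟩ := hf
  obtain ⟨ρ', hρ', K', hK'⟩ := hg
  refine ⟨min ρ ρ', lt_min hρ hρ', K + K', ?_⟩
  filter_upwards [hK, hK'] with n ⟨h1, h2⟩ ⟨h3, h4⟩
  refine ⟨fun x hx y hy => ?_, (norm_add_le _ _).trans (add_le_add h2 h4)⟩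
  rw [add_sub_add_comm, add_mul]
  exact (norm_add_le _ _).trans (add_le_add
    (h1 x (Metric.ball_subset_ball (min_le_left _ _) hx) y
      (Metric.ball_subset_ball (min_le_left _ _) hy))
    (h3 x (Metric.ball_subset_ball (min_le_right _ _) hx) y
      (Metric.ball_subset_ball (min_le_right _ _) hy)))

lemma EventuallyLipschitz.const_mul {f : ℕ → ℂ → ℂ} (hf : EventuallyLipschitz f) (c : ℂ) :
    EventuallyLipschitz fun n x => c * f n x := by
  obtain ⟨ρ, hρ, K, hK⟩ := hf
  refine ⟨ρ, hρ, ‖c‖ * K, ?_⟩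
  filter_upwards [hK] with n ⟨h1, h2⟩
  refine ⟨fun x hx y hy => ?_, ?_⟩
  · rw [← mul_sub, norm_mul, mul_assoc]
    exact mul_le_mul_of_nonneg_left (h1 x hx y hy) (norm_nonneg c)
  · rw [norm_mul]
    exact mul_le_mul_of_nonneg_left h2 (norm_nonneg c)

lemma EventuallyLipschitz.sum (s : Finset ι) {f : ι → ℕ → ℂ → ℂ}
    (hf : ∀ i ∈ s, EventuallyLipschitz (f i)) :
    EventuallyLipschitz fun n x => ∑ i ∈ s, f i n x := by
  classical
  induction s using Finset.induction_on with
  | empty => exact ⟨1, one_pos, 0, .of_forall fun n => by simp⟩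
  | insert a s ha ih =>
    simp only [Finset.sum_insert ha]
    exact (hf a (Finset.mem_insert_self a s)).add
      (ih fun i hi => hf i (Finset.mem_insert_of_mem hi))

lemma eventuallyLipschitz_of_analyticAt {f : ℂ → ℂ} {p : ℕ → ℂ} {q : ℂ} (hf : AnalyticAt ℂ f q)
    (hp : Tendsto p atTop (𝓝 q)) : EventuallyLipschitz fun n x => f (p n + x) := by
  obtain ⟨r, hr, K, hK⟩ := hf.exists_lipschitz_ball
  refine ⟨r / 2, half_pos hr, max K (‖f q‖ + 1), ?_⟩
  have h1 : ∀ᶠ n in atTop, ‖f (p n)‖ < ‖f q‖ + 1 :=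
    ((hf.continuousAt.tendsto.comp hp).norm).eventually_lt_const (lt_add_one _)
  have h2 : ∀ᶠ n in atTop, p n ∈ Metric.ball q (r / 2) :=
    hp (Metric.ball_mem_nhds q (half_pos hr))
  filter_upwards [h1, h2] with n hn1 hn2
  have hmem : ∀ x ∈ Metric.ball (0 : ℂ) (r / 2), p n + x ∈ Metric.ball q r := by
    intro x hx
    rw [mem_ball_iff_norm] at hn2 ⊢
    rw [mem_ball_zero_iff] at hx
    rw [add_sub_right_comm]
    linarith [norm_add_le (p n - q) x]
  refine ⟨fun x hx y hy => ?_, ?_⟩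
  · have h3 := hK _ (hmem x hx) _ (hmem y hy)
    rw [add_sub_add_left_eq_sub] at h3
    exact h3.trans (mul_le_mul_of_nonneg_right (le_max_left _ _) (norm_nonneg _))
  · rw [add_zero]
    exact hn1.le.trans (le_max_right _ _)

/-- Dividing the identity of `cluster_identity` by M² and letting |M| → ∞ leaves k(k - 1) = 0 for
the number k of points. -/
lemma cluster_card (C : Finset ι) {s : ℕ → ι → ℂ} {φ : ℂ → ℂ} {h : ℕ → ℂ → ℂ} {M : ℕ → ℂ}
    (hodd : ∀ x, φ (-x) = -φ x) (hφ : AnalyticAt ℂ φ 0) (hh : EventuallyLipschitz h)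
    (hs0 : ∀ n, ∀ j ∈ C, s n j ≠ 0) (hs : ∀ n, ∀ j ∈ C, ∀ l ∈ C, j ≠ l → s n j ≠ s n l)
    (hlim : ∀ j ∈ C, Tendsto (fun n => s n j) atTop (𝓝 0))
    (hMlim : Tendsto (fun n => ‖M n‖) atTop atTop)
    (hM : ∀ᶠ n in atTop, ∀ j ∈ C, (s n j)⁻¹ - 2 * ∑ l ∈ C, ((s n j - s n l)⁻¹ +
      φ (s n j - s n l)) + h n (s n j) = M n) :
    C.card ≤ 1 := by
  obtain ⟨ρ₁, hρ₁, K₁, hK₁⟩ := hφ.exists_lipschitz_ball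
  obtain ⟨ρ₂, hρ₂, K₂, hK₂⟩ := hh
  set ρ := min ρ₁ ρ₂ with hρdef
  have hρ : 0 < ρ := lt_min hρ₁ hρ₂
  set K := max K₁ K₂ with hK
  have hsmall : ∀ᶠ n in atTop, ∀ j ∈ C, ‖s n j‖ < ρ / 2 := by
    rw [Filter.eventually_all_finset]
    intro j hj
    have := (hlim j hj).norm
    rw [norm_zero] at this
    exact this.eventually_lt_const (half_pos hρ)
  have hid : ∀ᶠ n in atTop, ∃ v : ℂ × ℂ × ℂ, ‖v.1‖ ≤ C.card * (K + K * ρ) ∧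
      ‖v.2.1‖ ≤ C.card * (K + K * ρ) + (K + 2 * (C.card * (K * ρ))) ∧
      ‖v.2.2‖ ≤ C.card * K + 2 * (C.card * (C.card * K)) ∧
      (C.card * M n - v.1) * ((C.card - 1) * M n + v.2.1) = v.2.2 := by
    filter_upwards [hsmall, hK₂, hM] with n h1 ⟨h2, h3⟩ h4
    have hmono : ∀ {K' : ℝ} (_ : K' ≤ K) (x y : ℂ), K' * ‖x - y‖ ≤ K * ‖x - y‖ :=
      fun h x y => mul_le_mul_of_nonneg_right h (norm_nonneg _)
    obtain ⟨η, ξ, E, h5⟩ := cluster_identity C (K := K) (ρ := ρ) hodd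
      (fun x hx y hy => (hK₁ x (Metric.ball_subset_ball (min_le_left _ _) hx) y
        (Metric.ball_subset_ball (min_le_left _ _) hy)).trans (hmono (le_max_left _ _) x y))
      (fun x hx y hy => (h2 x (Metric.ball_subset_ball (min_le_right _ _) hx) y
        (Metric.ball_subset_ball (min_le_right _ _) hy)).trans (hmono (le_max_right _ _) x y))
      (h3.trans (le_max_right _ _)) (hs0 n) (hs n) h1 h4
    exact ⟨(η, ξ, E), h5⟩
  obtain ⟨v, hv⟩ := hid.choice
  have hM0 : ∀ᶠ n in atTop, M n ≠ 0 := by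
    filter_upwards [hMlim.eventually_gt_atTop 0] with n hn using norm_pos_iff.mp hn
  have t1 := tendsto_div_zero_of_norm_le hMlim (hv.mono fun n h => h.1)
  have t2 := tendsto_div_zero_of_norm_le hMlim (hv.mono fun n h => h.2.1)
  have t3 := tendsto_div_zero_of_norm_le hMlim (hv.mono fun n h => h.2.2.1)
  have t4 : Tendsto (fun n => (M n)⁻¹) atTop (𝓝 0) := by
    simpa using tendsto_div_zero_of_norm_le hMlim (x := fun _ => 1) (B := 1) (by simp)
  have t5 : Tendsto (fun n => ((C.card : ℂ) - (v n).1 / M n) *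
      ((C.card : ℂ) - 1 + (v n).2.1 / M n)) atTop (𝓝 ((C.card - 0) * (C.card - 1 + 0))) :=
    (t1.const_sub _).mul (t2.const_add _)
  have t6 := t3.mul t4
  have heq : (fun n => ((C.card : ℂ) - (v n).1 / M n) * ((C.card : ℂ) - 1 + (v n).2.1 / M n))
      =ᶠ[atTop] fun n => (v n).2.2 / M n * (M n)⁻¹ := by
    filter_upwards [hv, hM0] with n hn hn0
    rw [← hn.2.2.2]
    field_simp
  have hlim0 := tendsto_nhds_unique_of_eventuallyEq t5 t6 heq
  rw [sub_zero, add_zero, mul_zero, mul_eq_zero, sub_eq_zero] at hlim0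
  rcases hlim0 with h0 | h0
  · have : C.card = 0 := by exact_mod_cast h0
    omega
  · have : C.card = 1 := by exact_mod_cast h0
    omega

end Cluster

/-! ### Real coordinates and lattice congruence in the parallelogram. -/

section Parallelogram

variable {τ w : ℂ}

/-- The real number `b` in `x = a + b τ`. -/
noncomputable def coordTau (τ x : ℂ) : ℝ := x.im / τ.im

/-- The real number `a` in `x = a + b τ`. -/
noncomputable def coordOne (τ x : ℂ) : ℝ := x.re - x.im / τ.im * τ.re

lemma coord_eq (hτ : 0 < τ.im) (x : ℂ) : x = coordOne τ x + coordTau τ x * τ := by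
  apply Complex.ext
  · simp [coordOne, coordTau]
  · simp [coordTau, hτ.ne']

lemma coordTau_add_mul (hτ : 0 < τ.im) (a b : ℝ) : coordTau τ (a + b * τ) = b := by
  simp [coordTau, hτ.ne']

lemma coordOne_add_mul (hτ : 0 < τ.im) (a b : ℝ) : coordOne τ (a + b * τ) = a := by
  simp [coordOne, hτ.ne']

lemma coordTau_sub (x y : ℂ) : coordTau τ (x - y) = coordTau τ x - coordTau τ y := by
  simp [coordTau, sub_div]

lemma coordOne_sub (x y : ℂ) : coordOne τ (x - y) = coordOne τ x - coordOne τ y := by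
  simp [coordOne]
  ring

lemma continuous_coordTau : Continuous (coordTau τ) := by
  unfold coordTau
  fun_prop

lemma continuous_coordOne : Continuous (coordOne τ) := by
  unfold coordOne
  fun_prop

lemma mem_parallelogram_iff (hτ : 0 < τ.im) {x : ℂ} : x ∈ parallelogram τ w ↔
    (0 ≤ coordOne τ (x - w) ∧ coordOne τ (x - w) < 1) ∧
      0 ≤ coordTau τ (x - w) ∧ coordTau τ (x - w) < 1 := by
  constructor
  · rintro ⟨a, b, ha, ha', hb, hb', rfl⟩
    rw [add_assoc, add_sub_cancel_left, coordOne_add_mul hτ, coordTau_add_mul hτ]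
    exact ⟨⟨ha, ha'⟩, hb, hb'⟩
  · rintro ⟨⟨ha, ha'⟩, hb, hb'⟩
    refine ⟨_, _, ha, ha', hb, hb', ?_⟩
    rw [add_assoc, ← coord_eq hτ]
    ring

/-- An interior point can be moved slightly in the direction -(1 + τ) without leaving the
parallelogram. -/
lemma coord_pos_of_mem_interior (hτ : 0 < τ.im) {x : ℂ}
    (hx : x ∈ interior (parallelogram τ w)) :
    0 < coordOne τ (x - w) ∧ 0 < coordTau τ (x - w) := by
  have hlim : Tendsto (fun δ : ℝ => x - (δ + δ * τ)) (𝓝 0) (𝓝 x) := by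
    have : Continuous fun δ : ℝ => x - (δ + δ * τ) := by fun_prop
    simpa using this.tendsto 0
  have hev : ∀ᶠ δ : ℝ in 𝓝 0, x - (δ + δ * τ) ∈ parallelogram τ w :=
    hlim (mem_interior_iff_mem_nhds.mp hx)
  obtain ⟨δ, hδ, hδ0⟩ := ((hev.filter_mono (nhdsWithin_le_nhds (s := Set.Ioi (0 : ℝ)))).and
    self_mem_nhdsWithin).exists
  have h := (mem_parallelogram_iff hτ).mp hδ
  rw [sub_right_comm, coordOne_sub, coordTau_sub, coordOne_add_mul hτ, coordTau_add_mul hτ] at h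
  have hδ0' : 0 < δ := hδ0
  constructor <;> linarith [h.1.1, h.2.1]

lemma eq_of_sub_mem_lattice (hτ : 0 < τ.im) {x y : ℂ} (h : x - y ∈ lattice τ)
    (h1 : |coordOne τ (x - y)| < 1) (h2 : |coordTau τ (x - y)| < 1) : x = y := by
  obtain ⟨a, b, hab⟩ := h
  have e1 := coordOne_add_mul hτ a b
  have e2 := coordTau_add_mul hτ a b
  push_cast at e1 e2
  rw [← hab] at e1 e2
  rw [e1] at h1
  rw [e2] at h2
  have ha : a = 0 := Int.abs_lt_one_iff.mp (by exact_mod_cast h1)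
  have hb : b = 0 := Int.abs_lt_one_iff.mp (by exact_mod_cast h2)
  rw [ha, hb] at hab
  exact sub_eq_zero.mp (by simpa using hab)

lemma theta_sub_ne_zero (hτ : 0 < τ.im) {x y : ℂ} (hx : x ∈ parallelogram τ w)
    (hy : y ∈ parallelogram τ w) (hxy : x ≠ y) : theta τ (x - y) ≠ 0 := by
  rw [mem_parallelogram_iff hτ] at hx hy
  refine fun h => hxy (eq_of_sub_mem_lattice hτ ((theta_eq_zero_iff hτ).mp h) ?_ ?_)
  · rw [← sub_sub_sub_cancel_right x y w, coordOne_sub, abs_lt]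
    constructor <;> linarith [hx.1.1, hx.1.2, hy.1.1, hy.1.2]
  · rw [← sub_sub_sub_cancel_right x y w, coordTau_sub, abs_lt]
    constructor <;> linarith [hx.2.1, hx.2.2, hy.2.1, hy.2.2]

/-- The limit has coordinates in [0, 1] and the interior point has coordinates in (0, 1), so both
coordinates of the difference have absolute value below 1. For z on a side of the parallelogram this
would fail. -/
lemma eq_of_tendsto_of_sub_mem_lattice (hτ : 0 < τ.im) {x : ℕ → ℂ} {y z : ℂ}
    (hx : ∀ n, x n ∈ parallelogram τ w) (hlim : Tendsto x atTop (𝓝 y))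
    (hz : z ∈ interior (parallelogram τ w)) (h : y - z ∈ lattice τ) : y = z := by
  simp only [mem_parallelogram_iff hτ] at hx
  have hz' := (mem_parallelogram_iff hτ).mp (interior_subset hz)
  have hz'' := coord_pos_of_mem_interior hτ hz
  have l1 : Tendsto (fun n => coordOne τ (x n - w)) atTop (𝓝 (coordOne τ (y - w))) :=
    (continuous_coordOne.tendsto _).comp (hlim.sub_const w)
  have l2 : Tendsto (fun n => coordTau τ (x n - w)) atTop (𝓝 (coordTau τ (y - w))) :=
    (continuous_coordTau.tendsto _).comp (hlim.sub_const w)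
  have h1 := ge_of_tendsto' l1 fun n => (hx n).1.1
  have h2 := le_of_tendsto' l1 fun n => (hx n).1.2.le
  have h3 := ge_of_tendsto' l2 fun n => (hx n).2.1
  have h4 := le_of_tendsto' l2 fun n => (hx n).2.2.le
  refine eq_of_sub_mem_lattice hτ h ?_ ?_
  · rw [← sub_sub_sub_cancel_right y z w, coordOne_sub, abs_lt]
    constructor <;> linarith [hz'.1.2, hz''.1]
  · rw [← sub_sub_sub_cancel_right y z w, coordTau_sub, abs_lt]
    constructor <;> linarith [hz'.2.2, hz''.2]

lemma norm_le_of_mem_parallelogram {x : ℂ} (hx : x ∈ parallelogram τ w) :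
    ‖x‖ ≤ ‖w‖ + 1 + ‖τ‖ := by
  obtain ⟨a, b, ha, ha', hb, hb', rfl⟩ := hx
  refine (norm_add₃_le).trans ?_
  rw [norm_mul, norm_real, norm_real, Real.norm_of_nonneg ha, Real.norm_of_nonneg hb]
  have := mul_le_mul_of_nonneg_right hb'.le (norm_nonneg τ)
  linarith

end Parallelogram

/-! ### Bethe solutions for large μ lie near tuples of distinct z_a. -/

section Localization

variable {τ w : ℂ} {m n : ℕ} {z : Fin n → ℂ}

/-- If both multipliers are 1, then μ is an integer and, comparing imaginary parts, equals ∑ u_a - 2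
∑ v_j, where u_a, v_j ∈ [0, 1) are the τ-coordinates relative to w. This lies in [-2m, 2m]. -/
lemma hasNontrivialMultiplier_of_norm {z : Fin (2 * m) → ℂ} (hτ : 0 < τ.im) {t : Fin m → ℂ} {μ : ℂ}
    (hz : ∀ a, z a ∈ parallelogram τ w) (ht : ∀ j, t j ∈ parallelogram τ w)
    (hμ : 2 * m < ‖μ‖) : HasNontrivialMultiplier τ μ z t := by
  rintro ⟨h1, h2⟩
  obtain ⟨k, hk⟩ := Complex.exp_eq_one_iff.mp h1
  obtain ⟨l, hl⟩ := Complex.exp_eq_one_iff.mp h2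
  have hI : (2 * Real.pi * I : ℂ) ≠ 0 := Complex.two_pi_I_ne_zero
  have hμk : μ = ((-k : ℤ) : ℂ) := by
    refine mul_left_cancel₀ hI ?_
    push_cast
    linear_combination -hk
  have hl' : ∑ a, z a - 2 * ∑ j, t j - μ * τ = l := by
    refine mul_left_cancel₀ hI ?_
    linear_combination hl
  set u : Fin (2 * m) → ℝ := fun a => coordTau τ (z a - w) with hu
  set v : Fin m → ℝ := fun j => coordTau τ (t j - w) with hv
  have him := congrArg Complex.im hl'
  have hzim : ∀ a, (z a).im = w.im + u a * τ.im := fun a => by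
    simp only [hu, coordTau, sub_im]
    field_simp
    ring
  have htim : ∀ j, (t j).im = w.im + v j * τ.im := fun a => by
    simp only [hv, coordTau, sub_im]
    field_simp
    ring
  rw [hμk] at him
  simp only [sub_im, im_sum, hzim, mul_im, re_ofNat, im_ofNat, intCast_re, intCast_im, htim,
    Finset.sum_add_distrib, Finset.sum_const, Finset.card_univ, Fintype.card_fin, nsmul_eq_mul,
    ← Finset.sum_mul] at him
  push_cast at him
  have hk' : (∑ a, u a - 2 * ∑ j, v j) = ((-k : ℤ) : ℝ) := by
    refine mul_right_cancel₀ hτ.ne' ?_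
    push_cast
    linear_combination him
  have b1 : 0 ≤ ∑ a, u a := Finset.sum_nonneg fun a _ => ((mem_parallelogram_iff hτ).mp (hz a)).2.1
  have b2 : ∑ a, u a ≤ 2 * m := by
    refine (Finset.sum_le_card_nsmul _ _ 1 fun a _ =>
      ((mem_parallelogram_iff hτ).mp (hz a)).2.2.le).trans (by simp)
  have b3 : 0 ≤ ∑ j, v j := Finset.sum_nonneg fun a _ => ((mem_parallelogram_iff hτ).mp (ht a)).2.1
  have b4 : ∑ j, v j ≤ m := by
    refine (Finset.sum_le_card_nsmul _ _ 1 fun a _ =>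
      ((mem_parallelogram_iff hτ).mp (ht a)).2.2.le).trans (by simp)
  rw [hμk, Complex.norm_intCast, ← hk'] at hμ
  refine absurd hμ (not_lt.mpr (abs_le.mpr ⟨?_, ?_⟩)) <;> linarith

lemma zetaFun_zero : zetaFun τ 0 = 0 := by
  simp [zetaFun, logDeriv_apply, theta_zero]

/-- The term k = j may be included since `zetaFun` takes the value 0 at its pole 0 (division by
zero). -/
lemma IsBethe.eq {μ : ℂ} {t : Fin m → ℂ} (h : IsBethe τ μ z t) (j : Fin m) :
    ∑ a, zetaFun τ (t j - z a) - 2 * ∑ k, zetaFun τ (t j - t k) = 2 * Real.pi * I * μ := by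
  rw [← h j, Finset.sum_erase]
  rw [sub_self, zetaFun_zero]

/-- In the limit of large `μ`, every `t_j` approaches one of the `z_a` modulo the lattice. -/
lemma exists_sub_mem_lattice (hτ : 0 < τ.im) {μ : ℕ → ℂ} {t : ℕ → Fin m → ℂ} {t' : Fin m → ℂ}
    (hB : ∀ n, IsBethe τ (μ n) z (t n)) (hμ : Tendsto (fun n => ‖μ n‖) atTop atTop)
    (hlim : Tendsto t atTop (𝓝 t')) (j : Fin m) : ∃ a, t' j - z a ∈ lattice τ := by
  classical
  by_contra! hne
  have hlim' : ∀ k, Tendsto (fun n => t n k) atTop (𝓝 (t' k)) := fun k =>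
    (tendsto_pi_nhds.mp hlim) k
  -- Within this congruence class the interactions may diverge, but they cancel in the sum because ζ
  -- is odd. All other terms converge, whereas the right-hand side tends to infinity.
  set C : Finset (Fin m) := Finset.univ.filter fun k => t' k - t' j ∈ lattice τ with hC
  have hjC : j ∈ C := by simp [hC, zero_mem]
  have hcont : ∀ {x : ℂ}, x ∉ lattice τ → ContinuousAt (zetaFun τ) x := fun hx =>
    (analyticAt_zetaFun hτ (theta_ne_zero hτ hx)).continuousAt
  have h1 : ∀ k ∈ C, ∀ a, t' k - z a ∉ lattice τ := by
    intro k hk a h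
    refine hne a ?_
    have := sub_mem h (Finset.mem_filter.mp hk).2
    simpa using this
  have h2 : ∀ k ∈ C, ∀ l ∈ Cᶜ, t' k - t' l ∉ lattice τ := by
    intro k hk l hl h
    refine Finset.mem_compl.mp hl (Finset.mem_filter.mpr ⟨Finset.mem_univ l, ?_⟩)
    have := sub_mem (Finset.mem_filter.mp hk).2 h
    simpa using this
  have hsum : ∀ n, ∑ k ∈ C, (∑ a, zetaFun τ (t n k - z a)) -
      2 * ∑ k ∈ C, ∑ l ∈ Cᶜ, zetaFun τ (t n k - t n l) = C.card * (2 * Real.pi * I * μ n) := by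
    intro n
    have e1 : ∑ k ∈ C, 2 * Real.pi * I * μ n = C.card * (2 * Real.pi * I * μ n) := by simp
    have e2 : ∑ k ∈ C, ∑ l ∈ C, zetaFun τ (t n k - t n l) = 0 :=
      sum_sum_eq_zero_of_antisymm C fun k l => by rw [← zetaFun_neg, neg_sub]
    rw [← e1, ← Finset.sum_congr rfl fun k _ => (hB n).eq k, Finset.sum_sub_distrib,
      ← Finset.mul_sum]
    simp only [← Finset.sum_add_sum_compl C fun l => zetaFun τ (t n _ - t n l),
      Finset.sum_add_distrib, e2, zero_add]
  have hconv : Tendsto (fun n => C.card * (2 * Real.pi * I * μ n)) atTop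
      (𝓝 (∑ k ∈ C, (∑ a, zetaFun τ (t' k - z a)) -
        2 * ∑ k ∈ C, ∑ l ∈ Cᶜ, zetaFun τ (t' k - t' l))) := by
    simp only [← hsum]
    refine Tendsto.sub (tendsto_finsetSum _ fun k hk => tendsto_finsetSum _ fun a _ => ?_)
      (Tendsto.const_mul 2 (tendsto_finsetSum _ fun k hk => tendsto_finsetSum _ fun l hl => ?_))
    · exact (hcont (h1 k hk a)).tendsto.comp ((hlim' k).sub_const _)
    · exact (hcont (h2 k hk l hl)).tendsto.comp ((hlim' k).sub (hlim' l))
  have hcard : (0 : ℝ) < C.card := by exact_mod_cast Finset.card_pos.mpr ⟨j, hjC⟩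
  refine not_tendsto_nhds_of_tendsto_atTop ?_ _ hconv.norm
  simp only [norm_mul, ← mul_assoc]
  refine Tendsto.const_mul_atTop ?_ hμ
  simp [hcard]

/-- In the limit of large `μ`, distinct `t_j` approach distinct `z_a`. -/
lemma limit_injective (hτ : 0 < τ.im) (hz : ∀ a b, a ≠ b → theta τ (z a - z b) ≠ 0)
    {μ : ℕ → ℂ} {t : ℕ → Fin m → ℂ} {a : Fin m → Fin n}
    (hgen : ∀ n, IsGeneric τ z (t n)) (hB : ∀ n, IsBethe τ (μ n) z (t n))
    (hμ : Tendsto (fun n => ‖μ n‖) atTop atTop) (hlim : Tendsto t atTop (𝓝 (z ∘ a))) :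
    Function.Injective a := by
  classical
  intro j₁ j₂ hj
  by_contra hne
  have hlim' : ∀ k, Tendsto (fun n => t n k) atTop (𝓝 (z (a k))) := fun k =>
    (tendsto_pi_nhds.mp hlim) k
  set p := a j₁ with hp
  set C : Finset (Fin m) := Finset.univ.filter fun k => a k = p with hC
  have hmemC : ∀ {k}, k ∈ C ↔ a k = p := fun {k} => by simp [hC]
  -- Everything in the Bethe equation at t_j = z_p + x that is neither the pole at z_p nor an
  -- interaction within the cluster: all these terms are uniformly Lipschitz near x = 0.
  set h : ℕ → ℂ → ℂ := fun n x => ((zetaReg τ (0 + x)) +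
    ∑ b ∈ Finset.univ.erase p, zetaFun τ (z p - z b + x)) +
      (-2) * ∑ l ∈ Cᶜ, zetaFun τ (z p - t n l + x) with hh
  have hreg : AnalyticAt ℂ (zetaReg τ) 0 :=
    analyticAt_zetaReg hτ (by rw [thetaQuot_zero hτ]; exact one_ne_zero)
  have hhL : EventuallyLipschitz h := by
    refine ((eventuallyLipschitz_of_analyticAt hreg tendsto_const_nhds).add
      (EventuallyLipschitz.sum _ fun b hb => eventuallyLipschitz_of_analyticAt
        (analyticAt_zetaFun hτ (hz p b (Finset.ne_of_mem_erase hb).symm)) tendsto_const_nhds)).add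
      ((EventuallyLipschitz.sum _ fun l hl => eventuallyLipschitz_of_analyticAt
        (analyticAt_zetaFun hτ (hz p (a l) ?_)) ((hlim' l).const_sub _)).const_mul _)
    exact fun h => Finset.mem_compl.mp hl (hmemC.mpr h.symm)
  have hcard := cluster_card C (s := fun n j => t n j - z p) (φ := zetaReg τ) (h := h)
    (M := fun n => 2 * Real.pi * I * μ n) zetaReg_neg hreg hhL
    (fun n j _ h0 => (hgen n).left j p (by rw [h0, theta_zero]))
    (fun n j _ l _ hjl h0 => (hgen n).right j l hjl (by
      rw [sub_left_injective.eq_iff.mp h0, sub_self, theta_zero]))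
    (fun j hj => by
      have := (hlim' j).sub_const (z p)
      rwa [hmemC.mp hj, sub_self] at this)
    (by
      have : (0 : ℝ) < ‖(2 * Real.pi * I : ℂ)‖ := norm_pos_iff.mpr Complex.two_pi_I_ne_zero
      simp only [norm_mul _ (μ _)]
      exact Tendsto.const_mul_atTop this hμ)
    (.of_forall fun n j hj => by
      have hreg₂ : ∀ l ∈ C, (t n j - t n l)⁻¹ + zetaReg τ (t n j - t n l) =
          zetaFun τ (t n j - t n l) := by
        intro l hl
        by_cases hjl : j = l
        · rw [hjl, sub_self, zetaFun_zero, zetaReg_zero, inv_zero, add_zero]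
        · rw [zetaFun_eq hτ ((hgen n).right j l hjl), one_div]
      simp only [sub_sub_sub_cancel_right, hh, zero_add]
      rw [Finset.sum_congr rfl hreg₂, ← (hB n).eq j, ← Finset.sum_add_sum_compl C,
        ← Finset.add_sum_erase _ _ (Finset.mem_univ p), zetaFun_eq hτ ((hgen n).left j p)]
      have e1 : ∀ y : ℂ, z p - y + (t n j - z p) = t n j - y := fun y => by ring
      simp only [e1]
      ring)
  have h1 : j₁ ∈ C := hmemC.mpr rfl
  have h2 : j₂ ∈ C := hmemC.mpr hj.symm
  exact hne (Finset.card_le_one.mp hcard j₁ h1 j₂ h2)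

/-- For large `μ`, the solutions of the Bethe ansatz equations are near to tuples of distinct
points `z_a`. -/
lemma exists_near_of_isBethe (hτ : 0 < τ.im) (hz : ∀ a, z a ∈ interior (parallelogram τ w))
    (hz_inj : Function.Injective z) (m : ℕ) {r : ℝ} (hr : 0 < r) :
    ∃ N : ℝ, ∀ μ : ℂ, N < ‖μ‖ → ∀ t : Fin m → ℂ, (∀ j, t j ∈ parallelogram τ w) →
      IsGeneric τ z t → IsBethe τ μ z t →
      ∃ a : Fin m → Fin n, Function.Injective a ∧ ∀ j, ‖t j - z (a j)‖ ≤ r := by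
  by_contra! hcon
  choose μ hμ t ht hgen hB hfar using fun n : ℕ => hcon n
  have hbdd : ∀ n, t n ∈ Metric.closedBall (0 : Fin m → ℂ) (‖w‖ + 1 + ‖τ‖) := by
    intro n
    rw [mem_closedBall_zero_iff, pi_norm_le_iff_of_nonneg (by positivity)]
    exact fun j => norm_le_of_mem_parallelogram (ht n j)
  -- Compactness turns a sequence of counterexamples with |μ| → ∞ into a convergent one, to which
  -- the limit statements apply.
  obtain ⟨t', -, ψ, hψ, hlim⟩ := tendsto_subseq_of_bounded Metric.isBounded_closedBall hbdd
  have hμlim : Tendsto (fun n => ‖μ (ψ n)‖) atTop atTop :=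
    (tendsto_atTop_mono (fun n => (hμ n).le) tendsto_natCast_atTop_atTop).comp hψ.tendsto_atTop
  choose a ha using exists_sub_mem_lattice hτ (fun n => hB (ψ n)) hμlim hlim
  have ht' : t' = z ∘ a := funext fun j => eq_of_tendsto_of_sub_mem_lattice hτ
    (fun n => ht (ψ n) j) (tendsto_pi_nhds.mp hlim j) (hz (a j)) (ha j)
  rw [ht'] at hlim
  have hinj := limit_injective hτ (fun a b hab => theta_sub_ne_zero hτ (interior_subset (hz a))
    (interior_subset (hz b)) (hz_inj.ne hab)) (fun n => hgen (ψ n)) (fun n => hB (ψ n)) hμlim hlim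
  have hev : ∀ᶠ n in atTop, ∀ j, ‖t (ψ n) j - z (a j)‖ < r := by
    rw [Filter.eventually_all]
    intro j
    have := tendsto_iff_norm_sub_tendsto_zero.mp (tendsto_pi_nhds.mp hlim j)
    exact this.eventually_lt_const hr
  obtain ⟨n, hn⟩ := hev.exists
  obtain ⟨j, hj⟩ := hfar (ψ n) a hinj
  exact absurd (hn j) (not_lt.mpr hj.le)

end Localization

/-! ### One solution near each tuple, and a common radius. -/

section Counting

variable {τ w : ℂ} {m n : ℕ} {z : Fin n → ℂ}

/-- The regular part of the left-hand side of the Bethe ansatz equations at `t = z ∘ a + s`. -/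
noncomputable def betheReg (τ : ℂ) (z : Fin n → ℂ) (a : Fin m → Fin n) (s : Fin m → ℂ)
    (j : Fin m) : ℂ :=
  zetaReg τ (s j) + ∑ b ∈ Finset.univ.erase (a j), zetaFun τ (z (a j) + s j - z b) -
    2 * ∑ k ∈ Finset.univ.erase j, zetaFun τ (z (a j) + s j - (z (a k) + s k))

/-- At s = 0 the arguments of ζ are differences of distinct z_a, off the lattice, so the regular
part is analytic there. Holding for all small r, the bound allows one radius for the finitely many
tuples. -/
lemma eventually_lipschitzOnWith_betheReg (hτ : 0 < τ.im)
    (hz : ∀ a b, a ≠ b → theta τ (z a - z b) ≠ 0) {a : Fin m → Fin n}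
    (ha : Function.Injective a) :
    ∀ᶠ r in 𝓝[>] (0 : ℝ), ∃ K, LipschitzOnWith K (betheReg τ z a) (Metric.closedBall 0 r) := by
  have hcd : ContDiffAt ℂ 1 (betheReg τ z a) 0 := by
    rw [contDiffAt_pi]
    intro j
    unfold betheReg
    have hreg : ContDiffAt ℂ 1 (zetaReg τ) 0 :=
      (analyticAt_zetaReg hτ (by rw [thetaQuot_zero hτ]; exact one_ne_zero)).contDiffAt
    have hfun : ∀ {x : ℂ}, theta τ x ≠ 0 → ContDiffAt ℂ 1 (zetaFun τ) x := fun hx =>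
      (analyticAt_zetaFun hτ hx).contDiffAt
    refine ((?_ : ContDiffAt ℂ 1 _ _).add (ContDiffAt.sum fun b hb => ?_)).sub
      (contDiffAt_const.mul (ContDiffAt.sum fun k hk => ?_))
    · exact ContDiffAt.comp (g := zetaReg τ) (f := fun s : Fin m → ℂ => s j) 0 hreg (by fun_prop)
    · refine ContDiffAt.comp (g := zetaFun τ) (f := fun s : Fin m → ℂ => z (a j) + s j - z b) 0
        (hfun ?_) (by fun_prop)
      simpa using hz _ _ (Finset.ne_of_mem_erase hb).symm
    · refine ContDiffAt.comp (g := zetaFun τ)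
        (f := fun s : Fin m → ℂ => z (a j) + s j - (z (a k) + s k)) 0 (hfun ?_) (by fun_prop)
      simpa using hz _ _ (ha.ne (Finset.ne_of_mem_erase hk).symm)
  obtain ⟨K, U, hU, hK⟩ := hcd.exists_lipschitzOnWith
  obtain ⟨ε, hε, hεU⟩ := Metric.mem_nhds_iff.mp hU
  filter_upwards [Ioo_mem_nhdsGT hε] with r hr
  exact ⟨K, hK.mono ((Metric.closedBall_subset_ball hr.2).trans hεU)⟩

lemma isBethe_iff_betheReg (hτ : 0 < τ.im) {μ : ℂ} {a : Fin m → Fin n} {s : Fin m → ℂ}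
    (h : ∀ j, theta τ (s j) ≠ 0) :
    IsBethe τ μ z (fun j => z (a j) + s j) ↔
      ∀ j, 1 / s j + betheReg τ z a s j = 2 * Real.pi * I * μ := by
  refine forall_congr' fun j => ?_
  rw [← Finset.add_sum_erase _ _ (Finset.mem_univ (a j)), add_sub_cancel_left, zetaFun_eq hτ (h j),
    betheReg, add_sub_assoc, add_assoc, add_sub_assoc]

/-- Near each tuple of distinct points `z_a` there is exactly one solution of the Bethe ansatz
equations when `μ` is large. -/
lemma exists_unique_near (hτ : 0 < τ.im) {a : Fin m → Fin n} {r : ℝ} (hr : 0 < r)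
    (hball : ∀ b, Metric.closedBall (z b) r ⊆ parallelogram τ w)
    (hsep : ∀ b c, b ≠ c → 2 * r < ‖z b - z c‖) (ha : Function.Injective a)
    (hL : ∃ K, LipschitzOnWith K (betheReg τ z a) (Metric.closedBall 0 r)) :
    ∃ N : ℝ, ∀ μ : ℂ, N < ‖μ‖ → ∃ t : Fin m → ℂ, (∀ j, t j ∈ parallelogram τ w) ∧
      (∀ j, ‖t j - z (a j)‖ ≤ r) ∧ IsGeneric τ z t ∧ IsBethe τ μ z t ∧
      ∀ t' : Fin m → ℂ, (∀ j, ‖t' j - z (a j)‖ ≤ r) → IsGeneric τ z t' → IsBethe τ μ z t' →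
        t' = t := by
  obtain ⟨K, hK⟩ := hL
  obtain ⟨N, hN⟩ := existsUnique_small_solution hr hK
  have hpi : 0 < ‖(2 * Real.pi * I : ℂ)‖ := norm_pos_iff.mpr Complex.two_pi_I_ne_zero
  refine ⟨N / ‖(2 * Real.pi * I : ℂ)‖, fun μ hμ => ?_⟩
  rw [div_lt_iff₀ hpi, mul_comm, ← norm_mul] at hμ
  obtain ⟨s, ⟨hs, hsol⟩, huniq⟩ := hN _ hμ
  have hmem : ∀ b x, ‖x - z b‖ ≤ r → x ∈ parallelogram τ w := fun b x hx =>
    hball b (by rwa [mem_closedBall_iff_norm])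
  have hzmem : ∀ b, z b ∈ parallelogram τ w := fun b => hmem b _ (by simpa using hr.le)
  have hsr : ∀ j, ‖s j‖ ≤ r := fun j =>
    (norm_le_pi_norm s j).trans (by simpa using hs)
  set t : Fin m → ℂ := fun j => z (a j) + s j with ht
  have htr : ∀ j, ‖t j - z (a j)‖ ≤ r := fun j => by simpa [ht] using hsr j
  have htmem : ∀ j, t j ∈ parallelogram τ w := fun j => hmem _ _ (htr j)
  have htz : ∀ j b, t j ≠ z b := by
    intro j b h
    have hjb := htr j
    by_cases hab : a j = b
    · exact (hsol j).1 (by simpa [ht, hab] using h)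
    · rw [h, norm_sub_rev] at hjb
      linarith [hsep _ _ hab]
  have htt : ∀ j k, j ≠ k → t j ≠ t k := by
    intro j k hjk h
    have h1 := htr j
    have h2 := htr k
    rw [← h, norm_sub_rev] at h2
    have h3 := norm_add_le (z (a k) - t j) (t j - z (a j))
    rw [sub_add_sub_cancel, norm_sub_rev] at h3
    linarith [hsep _ _ (ha.ne hjk)]
  refine ⟨t, htmem, htr, ⟨fun j b => theta_sub_ne_zero hτ (htmem j) (hzmem b) (htz j b),
    fun j k hjk => theta_sub_ne_zero hτ (htmem j) (htmem k) (htt j k hjk)⟩, ?_, ?_⟩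
  · refine (isBethe_iff_betheReg hτ fun j => ?_).mpr fun j => (hsol j).2
    have := theta_sub_ne_zero hτ (htmem j) (hzmem (a j)) (htz j (a j))
    simpa [ht] using this
  · intro t' ht' hgen hB
    set s' : Fin m → ℂ := fun j => t' j - z (a j) with hs'
    have hts' : (fun j => z (a j) + s' j) = t' := funext fun j => by simp [hs']
    have h1 : ∀ j, theta τ (s' j) ≠ 0 := fun j => hgen.left j (a j)
    rw [← hts', isBethe_iff_betheReg hτ h1] at hB
    have h2 := huniq s' ⟨by
      rw [mem_closedBall_zero_iff, pi_norm_le_iff_of_nonneg hr.le]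
      exact ht', fun j => ⟨fun h0 => h1 j (by rw [h0, theta_zero]), hB j⟩⟩
    rw [← hts', h2]

lemma IsThetaRatio.eq_of_meromorphicOrderAt (hτ : 0 < τ.im) {t : Fin m → ℂ} {F : ℂ → ℂ}
    (hF : IsThetaRatio τ w m t F) {c x : ℂ} (hx : x ∈ parallelogram τ w)
    (h : meromorphicOrderAt (fun x => c * F x) x = -1) : ∃ k, x = t k := by
  by_contra! hne
  have hf : thetaProd τ t x ≠ 0 := thetaProd_ne_zero_iff.mpr fun j =>
    theta_sub_ne_zero hτ hx (hF.mem_parallelogram j) (hne j)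
  obtain ⟨g, ⟨hg, -⟩, rfl⟩ := hF.eq_div
  have han : AnalyticAt ℂ (fun x => c * (g x / thetaProd τ t x)) x :=
    analyticAt_const.mul ((hg.analyticAt x).div
      ((differentiable_thetaProd hτ t).analyticAt x) hf)
  have h0 := han.meromorphicOrderAt_nonneg
  have h' : meromorphicOrderAt (fun x => c * (g x / thetaProd τ t x)) x = -1 := h
  rw [h'] at h0
  exact absurd h0 (by decide)

lemma exists_perm_of_range_eq {α : Type*} {a b : Fin m → α} (ha : Function.Injective a)
    (hb : Function.Injective b) (h : Set.range a = Set.range b) :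
    ∃ σ : Equiv.Perm (Fin m), b = a ∘ σ := by
  refine ⟨((Equiv.ofInjective b hb).trans (Equiv.setCongr h.symm)).trans
    (Equiv.ofInjective a ha).symm, funext fun j => ?_⟩
  have := Equiv.apply_ofInjective_symm ha
    ((Equiv.setCongr h.symm) ((Equiv.ofInjective b hb) j))
  exact this.symm

lemma exists_radius (hz : ∀ a, z a ∈ interior (parallelogram τ w))
    (hz_inj : Function.Injective z) (hτ : 0 < τ.im) (m : ℕ) :
    ∃ r : ℝ, 0 < r ∧ (∀ b, Metric.closedBall (z b) r ⊆ parallelogram τ w) ∧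
      (∀ b c, b ≠ c → 2 * r < ‖z b - z c‖) ∧
      ∀ a : Fin m → Fin n, Function.Injective a →
        ∃ K, LipschitzOnWith K (betheReg τ z a) (Metric.closedBall 0 r) := by
  have h1 : ∀ᶠ r in 𝓝[>] (0 : ℝ), ∀ b, Metric.closedBall (z b) r ⊆ parallelogram τ w := by
    rw [Filter.eventually_all]
    intro b
    obtain ⟨ε, hε, h⟩ := Metric.mem_nhds_iff.mp (mem_interior_iff_mem_nhds.mp (hz b))
    filter_upwards [Ioo_mem_nhdsGT hε] with r hr
    exact (Metric.closedBall_subset_ball hr.2).trans h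
  have h2 : ∀ᶠ r in 𝓝[>] (0 : ℝ), ∀ b c, b ≠ c → 2 * r < ‖z b - z c‖ := by
    simp only [Filter.eventually_all]
    intro b c hbc
    have : 0 < ‖z b - z c‖ := norm_pos_iff.mpr (sub_ne_zero.mpr (hz_inj.ne hbc))
    filter_upwards [Ioo_mem_nhdsGT (half_pos this)] with r hr
    linarith [hr.2]
  have h3 : ∀ᶠ r in 𝓝[>] (0 : ℝ), ∀ a : Fin m → Fin n, Function.Injective a →
      ∃ K, LipschitzOnWith K (betheReg τ z a) (Metric.closedBall 0 r) := by
    simp only [Filter.eventually_all]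
    intro a ha
    exact eventually_lipschitzOnWith_betheReg hτ (fun b c hbc => theta_sub_ne_zero hτ
      (interior_subset (hz b)) (interior_subset (hz c)) (hz_inj.ne hbc)) ha
  obtain ⟨r, ⟨⟨h4, h5⟩, h6⟩, h7⟩ := (((h1.and h2).and h3).and self_mem_nhdsWithin).exists
  exact ⟨r, h7, h4, h5, h6⟩

end Counting

end EllipticWronski

/-! ### The count of classes by m-element subsets. -/

open EllipticWronski in
theorem mainTheorem6 (τ : ℂ) (hτ : 0 < τ.im) (w : ℂ) (m : ℕ) (hm : 0 < m)
    (z : Fin (2 * m) → ℂ) (hz : ∀ a, z a ∈ interior (EllipticWronski.parallelogram τ w))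
    (hz_inj : Function.Injective z) :
    ∃ N : ℝ, 0 < N ∧ ∀ μ : ℂ, N < ‖μ‖ →
      (EllipticWronski.thetaRatioClasses τ w m μ z).ncard = (2 * m).choose m := by
  obtain ⟨r, hr, hball, hsep, hL⟩ := exists_radius hz hz_inj hτ m
  obtain ⟨N₁, hN₁⟩ := exists_near_of_isBethe hτ hz hz_inj m hr
  have hinj : ∀ A : {A : Finset (Fin (2 * m)) // A.card = m},
      Function.Injective (A.1.orderEmbOfFin A.2) := fun A => (A.1.orderEmbOfFin A.2).injective
  choose N₂ hN₂ using fun A : {A : Finset (Fin (2 * m)) // A.card = m} =>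
    exists_unique_near hτ hr hball hsep (hinj A) (hL _ (hinj A))
  obtain ⟨N₃, hN₃⟩ := (Set.finite_range N₂).bddAbove
  have hzmem : ∀ a, z a ∈ parallelogram τ w := fun a => interior_subset (hz a)
  refine ⟨max (max N₁ N₃) (2 * m + 1), lt_max_of_lt_right (by positivity), fun μ hμ => ?_⟩
  have hμ₁ : N₁ < ‖μ‖ := ((le_max_left _ _).trans (le_max_left _ _)).trans_lt hμ
  have hμ₂ : ∀ A, N₂ A < ‖μ‖ := fun A => (hN₃ ⟨A, rfl⟩).trans_lt
    (((le_max_right _ _).trans (le_max_left _ _)).trans_lt hμ)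
  have hμ₃ : 2 * m < ‖μ‖ := by linarith [(le_max_right (max N₁ N₃) (2 * m + 1)).trans_lt hμ]
  choose t htmem htr hgen hB huniq using fun A => hN₂ A μ (hμ₂ A)
  choose F hF hF' using fun A => exists_isThetaRatio hτ hm (htmem A) (hgen A) (hB A)
    (hasNontrivialMultiplier_of_norm hτ hzmem (htmem A) hμ₃)
  have hset : thetaRatioClasses τ w m μ z =
      Set.range fun A => (Quotient.mk proportional (F A)) := by
    apply Set.Subset.antisymm
    · rintro _ ⟨G, ⟨u, hG, hG'⟩, rfl⟩
      obtain ⟨hgu, hBu⟩ := isBethe_of_isThetaRatio hτ hG hG' fun j k hjk =>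
        theta_sub_ne_zero hτ (hG.mem_parallelogram j) (hG.mem_parallelogram k)
          (hG.injective.ne hjk)
      obtain ⟨a, ha, hau⟩ := hN₁ μ hμ₁ u hG.mem_parallelogram hgu hBu
      -- Only the set of nearby z_a matters: a permutation of the poles brings them into the
      -- increasing order used for A, and local uniqueness then identifies them with `t A`.
      set A : {A : Finset (Fin (2 * m)) // A.card = m} :=
        ⟨Finset.univ.image a, by rw [Finset.card_image_of_injective _ ha]; simp⟩ with hA
      obtain ⟨σ, hσ⟩ := exists_perm_of_range_eq ha (hinj A) (by
        rw [Finset.range_orderEmbOfFin]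
        simp [hA])
      have hGσ := hG.comp_perm σ
      have hGσ' := hG'.comp_perm σ
      obtain ⟨hgσ, hBσ⟩ := isBethe_of_isThetaRatio hτ hGσ hGσ' fun j k hjk =>
        theta_sub_ne_zero hτ (hGσ.mem_parallelogram j) (hGσ.mem_parallelogram k)
          (hGσ.injective.ne hjk)
      have hut := huniq A (u ∘ σ) (fun j => by
        rw [hσ]
        exact hau (σ j)) hgσ hBσ
      rw [hut] at hGσ hGσ'
      obtain ⟨c, hc, hcF⟩ := exists_eq_smul_of_isThetaRatio hτ hm (hF A) (hF' A) hGσ hGσ' (hgen A)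
        (hB A) (hasNontrivialMultiplier_of_norm hτ hzmem (htmem A) hμ₃)
      exact ⟨A, Quotient.sound (s := proportional) ⟨Units.mk0 c hc, hcF.symm⟩⟩
    · rintro _ ⟨A, rfl⟩
      exact ⟨F A, ⟨t A, hF A, hF' A⟩, rfl⟩
  -- Proportional functions share their poles. A common pole is within r of a point z_a with a ∈ A
  -- and of a point z_b with b ∈ B; separation by more than 2r forces a = b, so A ⊆ B, and the
  -- cardinalities are equal.
  have hFinj : Function.Injective fun A => (Quotient.mk proportional (F A)) := by
    intro A B hAB
    obtain ⟨c, hc⟩ : ∃ c : ℂˣ, c • F B = F A := Quotient.exact hAB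
    refine Subtype.ext (Finset.eq_of_subset_of_card_le (fun a haA => ?_) (by rw [A.2, B.2]))
    obtain ⟨j, rfl⟩ : a ∈ Set.range (A.1.orderEmbOfFin A.2) := by
      rw [Finset.range_orderEmbOfFin]
      exact haA
    have hpole := (hF A).simple_pole j
    rw [← hc] at hpole
    obtain ⟨k, hk⟩ := (hF B).eq_of_meromorphicOrderAt hτ (htmem A j) hpole
    have h1 := htr A j
    have h2 := htr B k
    rw [hk, norm_sub_rev] at h1
    have h3 := norm_add_le (z (A.1.orderEmbOfFin A.2 j) - t B k)
      (t B k - z (B.1.orderEmbOfFin B.2 k))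
    rw [sub_add_sub_cancel] at h3
    by_contra hnot
    have hne : A.1.orderEmbOfFin A.2 j ≠ B.1.orderEmbOfFin B.2 k := fun h =>
      hnot (h ▸ Finset.orderEmbOfFin_mem _ _ _)
    linarith [hsep _ _ hne]
  rw [hset, Set.ncard_range_of_injective hFinj, Nat.card_eq_fintype_card, Fintype.card_finset_len,
    Fintype.card_fin]
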